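/- A graph is a diagram of finite sets $A \xleftarrow{s} H \xrightarrow{p} V$ with $s$ injective, together with a fixpoint-free involution $i$ on $A$ (arcs, half-edges, vertices). An edge is an $i$-orbit; it is isolated if neither of its arcs is in the image of $s$. A port is an arc outside the image of $s$. A graph is effective if it is nonempty and has no isolated edges. An etale morphism is a triple of maps commuting with $s$, $p$, $i$ whose $p$-square is a pullback. An open subgraph is given by a levelwise injective etale morphism. A reduced cover is an etale morphism that is surjective on edges and vertices and is not so when restricted to any proper open subgraph of its domain. Let $\widetilde{\mathbf{Gr}}$ be the restricted Kleisli category. Its objects are the graphs without isolated edges (the empty graph is allowed). A morphism $R\to Y$ consists of an $i$-equivariant map $A_R\to A_Y$ and, for every vertex $x$ of $R$, an isomorphism class of effective graphs $S_x$ etale over $Y$, with ports labelled by the half-edges $h$ at $x$, the port labelled $h$ lying over the image of $i(s(h))$. Composition is substitution of graphs into vertices. Every etale morphism is regarded as a (free) Kleisli morphism, sending each vertex to its corolla. A Kleisli morphism $R\to Y$ is generic if the graph $S$ obtained by gluing the graphs $S_x$ according to the incidences of $R$ maps isomorphically to $Y$. **Proposition.** Every reduced cover between graphs without isolated edges is an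 epimorphism in $\widetilde{\mathbf{Gr}}$. The classes of reduced covers and of generic morphisms in $\widetilde{\mathbf{Gr}}$ both contain the isomorphisms and are closed under composition, and they admit pushouts along each other, with the resulting new morphisms again a reduced cover and a generic morphism. Hence there is a category $\mathbf{Cosp}$ whose objects are the graphs without isolated edges, whose morphisms $T\to R$ are the isomorphism classes of cospans $T\to S\leftarrow R$ in $\widetilde{\mathbf{Gr}}$ with first leg a reduced cover and second leg a generic morphism, and whose composition is given by pushout. The category $\mathbf{Cosp}$ has a factorisation system whose left class consists of the (classes of) cospans $T\to R = R$ with first leg a reduced cover and second leg an identity, and whose right class consists of the (classes of) cospans $T = T\leftarrow R$ with first leg an identity and second leg a generic morphism. That is, both classes contain the isomorphisms and are closed under composition, every morphism factors as a morphism in the left class followed by a morphism in the right class, and any two such factorisations are related by a unique comparison isomorphism. -/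

import Mathlib

open CategoryTheory

universe u v

/-- A graph: finite sets of arcs `A`, half-edges (flags) `H` and vertices `V`, a fixpoint-free
involution on arcs, an injection `s : H → A` and a map `p : H → V`. -/
structure JKGraph : Type (u + 1) where
  A : Type u
  H : Type u
  V : Type u
  finA : Finite A
  finH : Finite H
  finV : Finite V
  inv : A → A
  s : H → A
  p : H → V
  inv_inv : ∀ a, inv (inv a) = a
  inv_ne : ∀ a, inv a ≠ a
  s_inj : Function.Injective s

namespace JKGraph

/-- A port is an arc not in the image of `s`. -/
def IsPort (G : JKGraph.{u}) (a : G.A) : Prop := a ∉ Set.range G.s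

/-- An arc of an inner edge: the arc and its opposite are both in the image of `s`. -/
def IsInner (G : JKGraph.{u}) (a : G.A) : Prop := a ∈ Set.range G.s ∧ G.inv a ∈ Set.range G.s

/-- No edge is isolated, i.e. every edge contains an arc in the image of `s`. -/
def NoIsolatedEdges (G : JKGraph.{u}) : Prop :=
  ∀ a : G.A, a ∈ Set.range G.s ∨ G.inv a ∈ Set.range G.s

/-- A graph is effective if it is nonempty and has no isolated edges. (Without isolated edges,
a graph is nonempty iff it has a vertex, since every edge is then incident to a vertex.) -/
def Effective (G : JKGraph.{u}) : Prop := Nonempty G.V ∧ G.NoIsolatedEdges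

/-- The half-edges at a vertex. -/
def Flag (G : JKGraph.{u}) (x : G.V) : Type u := {h : G.H // G.p h = x}

end JKGraph

/-- An etale morphism of graphs: levelwise maps commuting with the structure, such that the
square formed by the maps `p` is a pullback. -/
@[ext]
structure Etale (G G' : JKGraph.{u}) : Type u where
  arc : G.A → G'.A
  half : G.H → G'.H
  vert : G.V → G'.V
  arc_inv : ∀ a, arc (G.inv a) = G'.inv (arc a)
  arc_s : ∀ h, arc (G.s h) = G'.s (half h)
  vert_p : ∀ h, vert (G.p h) = G'.p (half h)
  pullback : ∀ (x : G.V) (h' : G'.H), G'.p h' = vert x → ∃! h : G.H, G.p h = x ∧ half h = h'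

namespace Etale

/-- The identity etale morphism. -/
def id (G : JKGraph.{u}) : Etale G G where
  arc a := a
  half h := h
  vert x := x
  arc_inv _ := rfl
  arc_s _ := rfl
  vert_p _ := rfl
  pullback _ h' e := ⟨h', ⟨e, rfl⟩, fun _ y => y.2⟩

/-- Composition of etale morphisms, in diagrammatic order. -/
def comp {G₁ G₂ G₃ : JKGraph.{u}} (f : Etale G₁ G₂) (g : Etale G₂ G₃) : Etale G₁ G₃ where
  arc a := g.arc (f.arc a)
  half h := g.half (f.half h)
  vert x := g.vert (f.vert x)
  arc_inv a := by rw [f.arc_inv, g.arc_inv]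
  arc_s h := by rw [f.arc_s, g.arc_s]
  vert_p h := by rw [f.vert_p, g.vert_p]
  pullback x h' e := by
    obtain ⟨k, ⟨hk, hk'⟩, uk⟩ := g.pullback _ _ e
    obtain ⟨l, ⟨hl, hl'⟩, ul⟩ := f.pullback _ _ hk
    refine ⟨l, ⟨hl, by rw [hl', hk']⟩, fun m hm => ul m ⟨hm.1, uk _ ⟨?_, hm.2⟩⟩⟩
    rw [← f.vert_p, hm.1]

/-- An etale morphism is invertible iff it is levelwise bijective. -/
def IsInvertible {G G' : JKGraph.{u}} (f : Etale G G') : Prop :=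
  Function.Bijective f.arc ∧ Function.Bijective f.half ∧ Function.Bijective f.vert

/-- An etale morphism identifies the half-edges at a vertex with those at the image vertex. -/
noncomputable def flagEquiv {G G' : JKGraph.{u}} (f : Etale G G') (x : G.V) :
    G.Flag x ≃ G'.Flag (f.vert x) :=
  Equiv.ofBijective (fun h => ⟨f.half h.1, by rw [← f.vert_p, h.2]⟩) <| by
    constructor
    · intro h k e
      obtain ⟨l, _, ul⟩ := f.pullback x (f.half h.1) (by rw [← f.vert_p, h.2])
      exact Subtype.ext ((ul _ ⟨h.2, rfl⟩).trans (ul _ ⟨k.2, (congrArg Subtype.val e).symm⟩).symm)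
    · intro h'
      obtain ⟨l, hl, _⟩ := f.pullback x h'.1 h'.2
      exact ⟨⟨l, hl.1⟩, Subtype.ext hl.2⟩

@[simp] theorem flagEquiv_val {G G' : JKGraph.{u}} (f : Etale G G') (x : G.V) (h : G.Flag x) :
    (f.flagEquiv x h).1 = f.half h.1 := rfl

end Etale

/-- An open subgraph of `G`. It is given by a set of arcs stable under the involution, and a set
of vertices; its half-edges are all half-edges at these vertices (so that the inclusion is
etale), whose arcs must belong to the subgraph. -/
structure OpenSubgraph (G : JKGraph.{u}) where
  arcs : Set G.A
  verts : Set G.V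
  inv_mem : ∀ a ∈ arcs, G.inv a ∈ arcs
  s_mem : ∀ h, G.p h ∈ verts → G.s h ∈ arcs

/-- An etale morphism is a reduced cover if it is surjective on edges (equivalently on arcs)
and on vertices, and no proper open subgraph of its domain still has this property. -/
def Etale.IsReducedCover {G G' : JKGraph.{u}} (f : Etale G G') : Prop :=
  Function.Surjective f.arc ∧ Function.Surjective f.vert ∧
    ∀ U : OpenSubgraph G, f.arc '' U.arcs = Set.univ → f.vert '' U.verts = Set.univ →
      U.arcs = Set.univ ∧ U.verts = Set.univ

/-- For a finite set `n`, an effective `n`-graph etale over `Y`: an effective graph, with a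
bijection from `n` to its set of ports, and an etale morphism to `Y`. -/
structure NGraph (n : Type u) (Y : JKGraph.{u}) : Type (u + 1) where
  G : JKGraph.{u}
  eff : G.Effective
  port : n ≃ {a : G.A // G.IsPort a}
  map : Etale G Y

namespace NGraph

/-- Isomorphism of `n`-graphs over `Y`: an isomorphism of graphs that respects the labelling of
the ports and the morphisms to `Y`. -/
def Rel {n : Type u} {Y : JKGraph.{u}} (P Q : NGraph n Y) : Prop :=
  ∃ e : Etale P.G Q.G, e.IsInvertible ∧
    (∀ k, e.arc (P.port k).1 = (Q.port k).1) ∧ e.comp Q.map = P.map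

/-- Relabelling of the ports. -/
def reindex {m n : Type u} {Y : JKGraph.{u}} (e : m ≃ n) (P : NGraph n Y) : NGraph m Y :=
  { P with port := e.trans P.port }

/-- An etale morphism between `n`-graphs that respects port labels and is bijective on vertices
is an isomorphism. -/
theorem isInvertible_of {n : Type u} {Y Z : JKGraph.{u}} (P : NGraph n Y) (Q : NGraph n Z)
    (e : Etale P.G Q.G) (hv : Function.Bijective e.vert)
    (hp : ∀ k, e.arc (P.port k).1 = (Q.port k).1) : e.IsInvertible := by
  have hh : Function.Bijective e.half := by
    constructor
    · intro h k ehk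
      have : P.G.p h = P.G.p k := hv.1 (by rw [e.vert_p, e.vert_p, ehk])
      obtain ⟨l, _, ul⟩ := e.pullback (P.G.p k) (e.half k) (e.vert_p k).symm
      exact (ul h ⟨this, ehk⟩).trans (ul k ⟨rfl, rfl⟩).symm
    · intro h'
      obtain ⟨x, hx⟩ := hv.2 (Q.G.p h')
      obtain ⟨l, hl, _⟩ := e.pullback x h' hx.symm
      exact ⟨l, hl.2⟩
  have key : ∀ a, (∃ h, a = P.G.s h) ∨ ∃ k, a = (P.port k).1 := by
    intro a
    by_cases ha : a ∈ Set.range P.G.s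
    · obtain ⟨h, rfl⟩ := ha; exact Or.inl ⟨h, rfl⟩
    · exact Or.inr ⟨P.port.symm ⟨a, ha⟩, by simp⟩
  refine ⟨⟨?_, ?_⟩, hh, hv⟩
  · intro a b eab
    rcases key a with ⟨h, rfl⟩ | ⟨k, rfl⟩ <;> rcases key b with ⟨h', rfl⟩ | ⟨k', rfl⟩
    · rw [e.arc_s, e.arc_s] at eab
      rw [hh.1 (Q.G.s_inj eab)]
    · rw [e.arc_s, hp] at eab
      exact absurd ⟨_, eab⟩ (Q.port k').2
    · rw [e.arc_s, hp] at eab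
      exact absurd ⟨_, eab.symm⟩ (Q.port k).2
    · rw [hp, hp] at eab
      rw [Q.port.injective (Subtype.ext eab)]
  · intro b
    by_cases hb : b ∈ Set.range Q.G.s
    · obtain ⟨h, rfl⟩ := hb
      obtain ⟨k, rfl⟩ := hh.2 h
      exact ⟨_, e.arc_s k⟩
    · exact ⟨_, (hp (Q.port.symm ⟨b, hb⟩)).trans (by simp)⟩

theorem Rel.refl {n : Type u} {Y : JKGraph.{u}} (P : NGraph n Y) : Rel P P :=
  ⟨Etale.id _, ⟨Function.bijective_id, Function.bijective_id, Function.bijective_id⟩,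
    fun _ => rfl, rfl⟩

theorem Rel.symm {n : Type u} {Y : JKGraph.{u}} {P Q : NGraph n Y} (r : Rel P Q) : Rel Q P := by
  obtain ⟨e, ⟨ha, hh, hv⟩, hp, hm⟩ := r
  let a := Equiv.ofBijective _ ha
  let h := Equiv.ofBijective _ hh
  let x := Equiv.ofBijective _ hv
  have ea : ∀ t, e.arc (a.symm t) = t := a.apply_symm_apply
  have eh : ∀ t, e.half (h.symm t) = t := h.apply_symm_apply
  have ex : ∀ t, e.vert (x.symm t) = t := x.apply_symm_apply
  refine ⟨⟨a.symm, h.symm, x.symm, ?_, ?_, ?_, ?_⟩, ⟨a.symm.bijective, h.symm.bijective,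
    x.symm.bijective⟩, ?_, ?_⟩
  · intro t; apply ha.1; rw [e.arc_inv, ea, ea]
  · intro t; apply ha.1; rw [e.arc_s, ea, eh]
  · intro t; apply hv.1; rw [e.vert_p, ex, eh]
  · intro y k hk
    refine ⟨e.half k, ⟨?_, h.symm_apply_apply k⟩, ?_⟩
    · rw [← e.vert_p, hk, ex]
    · rintro l ⟨_, rfl⟩; rw [eh]
  · intro k; apply ha.1; rw [hp]; exact ea _
  · rw [← hm]
    ext t
    · exact congrArg Q.map.arc (ea t)
    · exact congrArg Q.map.half (eh t)
    · exact congrArg Q.map.vert (ex t)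

theorem Rel.trans {n : Type u} {Y : JKGraph.{u}} {P Q R : NGraph n Y} (r : Rel P Q)
    (r' : Rel Q R) : Rel P R := by
  obtain ⟨e, ⟨ha, hh, hv⟩, hp, hm⟩ := r
  obtain ⟨e', ⟨ha', hh', hv'⟩, hp', hm'⟩ := r'
  refine ⟨e.comp e', ⟨ha'.comp ha, hh'.comp hh, hv'.comp hv⟩, fun k => ?_, ?_⟩
  · exact (congrArg e'.arc (hp k)).trans (hp' k)
  · rw [← hm, ← hm']; rfl

/-- The setoid of isomorphism of `n`-graphs over `Y`. -/
instance setoid (n : Type u) (Y : JKGraph.{u}) : Setoid (NGraph n Y) :=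
  ⟨Rel, Rel.refl, Rel.symm, Rel.trans⟩

theorem Rel.reindex {m n : Type u} {Y : JKGraph.{u}} (e : m ≃ n) {P Q : NGraph n Y}
    (r : Rel P Q) : Rel (P.reindex e) (Q.reindex e) := by
  obtain ⟨f, hf, hp, hm⟩ := r
  exact ⟨f, hf, fun k => hp (e k), hm⟩

end NGraph

/-- The value at the corolla on `n` of the graphical species obtained by applying the monad to
`Y`: the set of isomorphism classes of effective `n`-graphs over `Y`. -/
def NClass (n : Type u) (Y : JKGraph.{u}) : Type (u + 1) := Quotient (NGraph.setoid n Y)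

namespace NClass

/-- The projections of an operation to the colours: the arc of `Y` at the port labelled `k`. -/
def boundary {n : Type u} {Y : JKGraph.{u}} (c : NClass n Y) (k : n) : Y.A :=
  Quotient.lift (fun P : NGraph n Y => P.map.arc (P.port k).1)
    (by
      rintro P Q ⟨e, -, hp, hm⟩
      show P.map.arc _ = Q.map.arc _
      rw [← hm, ← hp]; rfl) c

/-- Relabelling of the ports. -/
def reindex {m n : Type u} {Y : JKGraph.{u}} (e : m ≃ n) (c : NClass n Y) : NClass m Y :=
  Quotient.map (NGraph.reindex e) (fun _ _ r => NGraph.Rel.reindex e r) c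

theorem boundary_out {n : Type u} {Y : JKGraph.{u}} (c : NClass n Y) (k : n) :
    c.out.map.arc (c.out.port k).1 = c.boundary k := by
  conv_rhs => rw [← Quotient.out_eq c]
  rfl

end NClass

/-- A Kleisli morphism from `R` to `Y`, i.e. a morphism of graphical species from `R` to the free
compact coloured prop on `Y`: arcs are sent to arcs (compatibly with the involutions), and every
vertex `x` is sent to an isomorphism class of effective graphs over `Y` whose ports are labelled
by the half-edges at `x`. The half-edge `h` corresponds to the port `i (s h)` of the corolla
at `x`, and the two assignments must agree there. -/
@[ext]
structure KHom (R Y : JKGraph.{u}) : Type (u + 1) where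
  arc : R.A → Y.A
  arc_inv : ∀ a, arc (R.inv a) = Y.inv (arc a)
  sub : ∀ x : R.V, NClass (R.Flag x) Y
  compat : ∀ (x : R.V) (h : R.Flag x), (sub x).boundary h = arc (R.inv (R.s h.1))

namespace JKGraph

variable (G : JKGraph.{u}) {Z : JKGraph.{u}} (K : ∀ x : G.V, NGraph (G.Flag x) Z)

open Classical in
/-- The graph obtained from `G` by substituting, for every vertex `x`, the effective graph `K x`,
whose ports are labelled by the half-edges at `x`. It is the levelwise colimit (gluing) of the
graphs `K x` according to the recipe that assembles `G` from its vertices and edges: the vertices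
and half-edges are those of the graphs `K x`; as no `K x` has isolated edges, every arc is either
an arc of `G` or an arc of an inner edge of a unique `K x`, and an arc `s k` of `K x` opposite to
the port labelled `h` is identified with the arc `s h` of `G`. -/
noncomputable def glue : JKGraph.{u} where
  A := G.A ⊕ (Σ x : G.V, {a : (K x).G.A // (K x).G.IsInner a})
  H := Σ x : G.V, (K x).G.H
  V := Σ x : G.V, (K x).G.V
  finA := by
    have := G.finA; have := G.finV; have := fun x => (K x).G.finA
    infer_instance
  finH := by
    have := G.finV; have := fun x => (K x).G.finH
    infer_instance
  finV := by
    have := G.finV; have := fun x => (K x).G.finV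
    infer_instance
  inv := Sum.map G.inv
    (fun a => ⟨a.1, (K a.1).G.inv a.2.1, a.2.2.2, by rw [inv_inv]; exact a.2.2.1⟩)
  s k := if hk : (K k.1).G.IsPort ((K k.1).G.inv ((K k.1).G.s k.2)) then
      Sum.inl (G.s ((K k.1).port.symm ⟨_, hk⟩).1)
    else Sum.inr ⟨k.1, (K k.1).G.s k.2, ⟨_, rfl⟩, not_not.1 hk⟩
  p k := ⟨k.1, (K k.1).G.p k.2⟩
  inv_inv := by
    rintro (a | ⟨x, a, ha⟩)
    · simp [inv_inv]
    · simp [inv_inv]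
  inv_ne := by
    rintro (a | ⟨x, a, ha⟩) e
    · exact G.inv_ne a (Sum.inl.inj e)
    · exact (K x).G.inv_ne a
        (congrArg Subtype.val (eq_of_heq (Sigma.mk.inj (Sum.inr.inj e)).2))
  s_inj := by
    rintro ⟨x, k⟩ ⟨y, l⟩ e
    dsimp only at e
    split_ifs at e with h1 h2 h2
    · have e1 := G.s_inj (Sum.inl.inj e)
      obtain rfl : x = y := by
        rw [← ((K x).port.symm ⟨_, h1⟩).2, ← ((K y).port.symm ⟨_, h2⟩).2, e1]
      have e2 := congrArg Subtype.val ((K x).port.symm.injective (Subtype.ext e1))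
      have e3 := congrArg (K x).G.inv e2
      simp only [inv_inv] at e3
      rw [(K x).G.s_inj e3]
    · have := Sum.inr.inj e
      obtain ⟨rfl, e⟩ := Sigma.mk.inj this
      have := congrArg Subtype.val (eq_of_heq e)
      rw [(K x).G.s_inj this]

variable {G K}

theorem glue_s_port (x : G.V) (k : (K x).G.H) (h : G.Flag x)
    (e : (K x).G.inv ((K x).G.s k) = ((K x).port h).1) :
    (G.glue K).s ⟨x, k⟩ = Sum.inl (G.s h.1) := by
  have hp : (K x).G.IsPort ((K x).G.inv ((K x).G.s k)) := by rw [e]; exact ((K x).port h).2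
  have : (K x).port.symm ⟨_, hp⟩ = h := by
    rw [Equiv.symm_apply_eq]; exact Subtype.ext e
  simp only [glue, dif_pos hp, this]

theorem glue_s_inner (x : G.V) (k : (K x).G.H)
    (e : (K x).G.inv ((K x).G.s k) ∈ Set.range (K x).G.s) :
    (G.glue K).s ⟨x, k⟩ = Sum.inr ⟨x, (K x).G.s k, ⟨_, rfl⟩, e⟩ := by
  have hp : ¬ (K x).G.IsPort ((K x).G.inv ((K x).G.s k)) := not_not.2 e
  simp only [glue, dif_neg hp]

theorem half_cases (x : G.V) (k : (K x).G.H) :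
    (∃ h : G.Flag x, (K x).G.inv ((K x).G.s k) = ((K x).port h).1) ∨
      (K x).G.inv ((K x).G.s k) ∈ Set.range (K x).G.s := by
  by_cases hp : (K x).G.inv ((K x).G.s k) ∈ Set.range (K x).G.s
  · exact Or.inr hp
  · exact Or.inl ⟨(K x).port.symm ⟨_, hp⟩, by simp⟩

/-- Every half-edge `h` of `G` gives a half-edge of the glued graph. -/
theorem exists_half (h : G.H) :
    ∃ k : (K (G.p h)).G.H, (K (G.p h)).G.s k =
      (K (G.p h)).G.inv ((K (G.p h)).port ⟨h, rfl⟩).1 := by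
  rcases (K (G.p h)).eff.2 ((K (G.p h)).port ⟨h, rfl⟩).1 with hk | ⟨k, hk⟩
  · exact absurd hk ((K (G.p h)).port ⟨h, rfl⟩).2
  · exact ⟨k, hk⟩

theorem glue_inl_mem (h : G.H) : (Sum.inl (G.s h) : (G.glue K).A) ∈ Set.range (G.glue K).s := by
  obtain ⟨k, hk⟩ := exists_half (K := K) h
  exact ⟨⟨G.p h, k⟩, glue_s_port _ _ ⟨h, rfl⟩ (by rw [hk, inv_inv])⟩

theorem glue_inl_isPort (a : G.A) : (G.glue K).IsPort (Sum.inl a) ↔ G.IsPort a := by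
  constructor
  · rintro h ⟨k, rfl⟩
    exact h (glue_inl_mem k)
  · rintro h ⟨⟨x, k⟩, e⟩
    rcases half_cases x k with ⟨l, hl⟩ | hl
    · rw [glue_s_port x k l hl] at e
      exact h ⟨_, Sum.inl.inj e⟩
    · rw [glue_s_inner x k hl] at e
      cases e

theorem glue_inr_mem (a : Σ x : G.V, {a : (K x).G.A // (K x).G.IsInner a}) :
    (Sum.inr a : (G.glue K).A) ∈ Set.range (G.glue K).s := by
  obtain ⟨x, a, ⟨k, rfl⟩, ha⟩ := a
  exact ⟨⟨x, k⟩, glue_s_inner x k ha⟩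

variable (G K) in
/-- The ports of the glued graph are the ports of `G`. -/
def gluePort : {a : G.A // G.IsPort a} ≃ {a : (G.glue K).A // (G.glue K).IsPort a} where
  toFun a := ⟨Sum.inl a.1, (glue_inl_isPort a.1).2 a.2⟩
  invFun
    | ⟨Sum.inl a, ha⟩ => ⟨a, (glue_inl_isPort a).1 ha⟩
    | ⟨Sum.inr a, ha⟩ => absurd (glue_inr_mem a) ha
  left_inv _ := rfl
  right_inv
    | ⟨Sum.inl _, _⟩ => rfl
    | ⟨Sum.inr a, ha⟩ => absurd (glue_inr_mem a) ha

theorem glue_noIsolatedEdges (hG : G.NoIsolatedEdges) : (G.glue K).NoIsolatedEdges := by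
  rintro (a | a)
  · rcases hG a with ⟨h, rfl⟩ | ⟨h, e⟩
    · exact Or.inl (glue_inl_mem h)
    · right
      have := glue_inl_mem (K := K) h
      rwa [e] at this
  · exact Or.inl (glue_inr_mem a)

theorem glue_effective (hG : G.Effective) : (G.glue K).Effective := by
  refine ⟨?_, glue_noIsolatedEdges hG.2⟩
  obtain ⟨x⟩ := hG.1
  obtain ⟨y⟩ := (K x).eff.1
  exact ⟨⟨x, y⟩⟩

variable (G K) in
/-- A map `α` on arcs that agrees with the graphs `K x` over `Z` at their ports induces an etale
morphism from the glued graph to `Z`. -/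
noncomputable def glueMap (α : G.A → Z.A) (hα : ∀ a, α (G.inv a) = Z.inv (α a))
    (hK : ∀ (x : G.V) (h : G.Flag x), (K x).map.arc ((K x).port h).1 = α (G.inv (G.s h.1))) :
    Etale (G.glue K) Z where
  arc := Sum.elim α (fun a => (K a.1).map.arc a.2.1)
  half k := (K k.1).map.half k.2
  vert y := (K y.1).map.vert y.2
  arc_inv := by
    rintro (a | ⟨x, a⟩)
    · exact hα a
    · exact (K x).map.arc_inv _
  arc_s := by
    rintro ⟨x, k⟩
    rcases half_cases x k with ⟨l, hl⟩ | hl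
    · rw [glue_s_port x k l hl]
      have := hK x l
      rw [← hl, Etale.arc_inv, Etale.arc_s, hα] at this
      have := congrArg Z.inv this
      rw [Z.inv_inv, Z.inv_inv] at this
      exact this.symm
    · rw [glue_s_inner x k hl]
      exact (K x).map.arc_s _
  vert_p k := (K k.1).map.vert_p k.2
  pullback := by
    rintro ⟨x, y⟩ h' e
    obtain ⟨k, ⟨hk, hk'⟩, u⟩ := (K x).map.pullback y h' e
    refine ⟨⟨x, k⟩, ⟨congrArg (Sigma.mk x) hk, hk'⟩, ?_⟩
    rintro ⟨x', l⟩ ⟨hl, hl'⟩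
    obtain ⟨rfl, hl⟩ := Sigma.mk.inj hl
    rw [u l ⟨eq_of_heq hl, hl'⟩]

/-- An etale morphism `e : G → G'` together with isomorphisms `K x ≅ K' (e x)` induces an etale
morphism of glued graphs. -/
theorem exists_glueHom {G' : JKGraph.{u}} {K' : ∀ x : G'.V, NGraph (G'.Flag x) Z}
    (e : Etale G G')
    (θ : ∀ x, NGraph.Rel (K x) ((K' (e.vert x)).reindex (e.flagEquiv x))) :
    ∃ F : Etale (G.glue K) (G'.glue K'),
      (∀ a, F.arc (Sum.inl a) = Sum.inl (e.arc a)) ∧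
      (Function.Bijective e.vert → Function.Bijective F.vert) ∧
      ∀ α hα hK α' hα' hK', (∀ a, α' (e.arc a) = α a) →
        F.comp (G'.glueMap K' α' hα' hK') = G.glueMap K α hα hK := by
  choose t ht hp hm using θ
  have inner : ∀ x a, (K x).G.IsInner a → (K' (e.vert x)).G.IsInner ((t x).arc a) := by
    rintro x a ⟨⟨k, rfl⟩, ⟨l, hl⟩⟩
    exact ⟨⟨_, ((t x).arc_s k).symm⟩, ⟨(t x).half l,
      ((t x).arc_s l).symm.trans ((congrArg _ hl).trans ((t x).arc_inv _))⟩⟩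
  refine ⟨⟨Sum.map e.arc (fun a => ⟨e.vert a.1, (t a.1).arc a.2.1, inner _ _ a.2.2⟩),
    fun k => ⟨e.vert k.1, (t k.1).half k.2⟩, fun y => ⟨e.vert y.1, (t y.1).vert y.2⟩,
    ?_, ?_, ?_, ?_⟩, ?_, ?_, ?_⟩
  · rintro (a | ⟨x, a, ha⟩)
    · exact congrArg Sum.inl (e.arc_inv a)
    · refine congrArg Sum.inr (congrArg (Sigma.mk (e.vert x)) (Subtype.ext ?_))
      exact (t x).arc_inv a
  · rintro ⟨x, k⟩
    rcases half_cases x k with ⟨l, hl⟩ | hl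
    · rw [glue_s_port x k l hl, glue_s_port (K := K') (e.vert x) ((t x).half k)
        (e.flagEquiv x l)]
      · exact congrArg Sum.inl (e.arc_s _)
      · have h1 := (t x).arc_s k
        have h2 := (t x).arc_inv ((K x).G.s k)
        have h3 := hp x l
        rw [← hl, h2, h1] at h3
        exact h3
    · have hl' : (K' (e.vert x)).G.inv ((K' (e.vert x)).G.s ((t x).half k)) ∈
          Set.range (K' (e.vert x)).G.s := by
        have h1 := (t x).arc_s k
        have := (inner x _ ⟨⟨k, rfl⟩, hl⟩).2
        rw [h1] at this; exact this
      rw [glue_s_inner x k hl, glue_s_inner (K := K') _ _ hl']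
      refine congrArg Sum.inr (congrArg (Sigma.mk (e.vert x)) (Subtype.ext ?_))
      exact (t x).arc_s k
  · rintro ⟨x, k⟩
    exact congrArg (Sigma.mk (e.vert x)) ((t x).vert_p k)
  · rintro ⟨x, y⟩ ⟨x', h'⟩ eq
    obtain ⟨rfl, eq⟩ := Sigma.mk.inj eq
    obtain ⟨k, ⟨hk, hk'⟩, w⟩ := (t x).pullback y h' (eq_of_heq eq)
    refine ⟨⟨x, k⟩, ⟨congrArg (Sigma.mk x) hk, congrArg (Sigma.mk _) hk'⟩, ?_⟩
    rintro ⟨x', l⟩ ⟨hl, hl'⟩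
    obtain ⟨rfl, hl⟩ := Sigma.mk.inj hl
    have hl' := eq_of_heq (Sigma.mk.inj hl').2
    rw [w l ⟨eq_of_heq hl, hl'⟩]
  · intro a; rfl
  · intro hv
    constructor
    · rintro ⟨x, y⟩ ⟨x', y'⟩ eq
      have h1 := hv.1 (Sigma.mk.inj eq).1
      dsimp only at h1
      subst h1
      exact congrArg (Sigma.mk x) ((ht x).2.2.1 (eq_of_heq (Sigma.mk.inj eq).2))
    · rintro ⟨x', y'⟩
      obtain ⟨x, rfl⟩ := hv.2 x'
      obtain ⟨y, hy⟩ := (ht x).2.2.2 y'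
      exact ⟨⟨x, y⟩, congrArg (Sigma.mk _) hy⟩
  · intro α hα hK α' hα' hK' hh
    ext z
    · rcases z with a | ⟨x, a⟩
      · exact hh a
      · exact congrArg (fun f => f.arc a.1) (hm x)
    · exact congrArg (fun f => f.half z.2) (hm z.1)
    · exact congrArg (fun f => f.vert z.2) (hm z.1)

end JKGraph

namespace NGraph

/-- Substitution of the graphs `K x` over `Z` into the vertices of an `n`-graph `P`. -/
noncomputable def subst {n : Type u} {Y Z : JKGraph.{u}} (P : NGraph n Y)
    (K : ∀ x : P.G.V, NGraph (P.G.Flag x) Z) (α : P.G.A → Z.A)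
    (hα : ∀ a, α (P.G.inv a) = Z.inv (α a))
    (hK : ∀ (x : P.G.V) (h : P.G.Flag x),
      (K x).map.arc ((K x).port h).1 = α (P.G.inv (P.G.s h.1))) : NGraph n Z where
  G := P.G.glue K
  eff := JKGraph.glue_effective P.eff
  port := P.port.trans (P.G.gluePort K)
  map := P.G.glueMap K α hα hK

theorem subst_rel {n : Type u} {Y Z : JKGraph.{u}} {P P' : NGraph n Y} {K K' α hα hK α' hα' hK'}
    (e : Etale P.G P'.G) (he : Function.Bijective e.vert)
    (hp : ∀ k, e.arc (P.port k).1 = (P'.port k).1)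
    (θ : ∀ x, Rel (K x) ((K' (e.vert x)).reindex (e.flagEquiv x)))
    (hh : ∀ a, α' (e.arc a) = α a) :
    Rel (P.subst (Z := Z) K α hα hK) (P'.subst K' α' hα' hK') := by
  obtain ⟨F, h1, h2, h3⟩ := JKGraph.exists_glueHom e θ
  have hp' : ∀ k, F.arc ((P.subst K α hα hK).port k).1 = ((P'.subst K' α' hα' hK').port k).1 :=
    fun k => (h1 _).trans (congrArg Sum.inl (hp k))
  exact ⟨F, isInvertible_of (P.subst K α hα hK) (P'.subst K' α' hα' hK') F (h2 he) hp', hp',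
    h3 α hα hK α' hα' hK' hh⟩

/-- The graphs to be substituted in `P` in order to compose with the Kleisli morphism `ψ`. -/
noncomputable def family {n : Type u} {Y Z : JKGraph.{u}} (P : NGraph n Y) (ψ : KHom Y Z)
    (x : P.G.V) : NGraph (P.G.Flag x) Z :=
  (ψ.sub (P.map.vert x)).out.reindex (P.map.flagEquiv x)

/-- The action of a Kleisli morphism `Y → Z` on `n`-graphs over `Y`: every vertex is substituted
by the graph assigned to its image in `Y`. -/
noncomputable def bind {n : Type u} {Y Z : JKGraph.{u}} (P : NGraph n Y) (ψ : KHom Y Z) :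
    NGraph n Z :=
  P.subst (P.family ψ) (fun a => ψ.arc (P.map.arc a))
    (fun a => by rw [P.map.arc_inv, ψ.arc_inv]) (fun x h => by
      refine (NClass.boundary_out _ _).trans ((ψ.compat _ _).trans ?_)
      rw [Etale.flagEquiv_val, P.map.arc_inv, P.map.arc_s])

theorem bind_rel {n : Type u} {Y Z : JKGraph.{u}} {P Q : NGraph n Y} (r : Rel P Q)
    (ψ : KHom Y Z) : Rel (P.bind ψ) (Q.bind ψ) := by
  obtain ⟨e, he, hp, hm⟩ := r
  obtain ⟨G, eff, port, map⟩ := P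
  dsimp only at e hm hp he
  subst hm
  exact subst_rel e he.2.2 hp (fun x => Rel.refl _) (fun a => rfl)

end NGraph

/-- The action of a Kleisli morphism on isomorphism classes of `n`-graphs. -/
noncomputable def NClass.bind {n : Type u} {Y Z : JKGraph.{u}} (c : NClass n Y) (ψ : KHom Y Z) :
    NClass n Z :=
  Quotient.map (fun P : NGraph n Y => P.bind ψ) (fun _ _ r => NGraph.bind_rel r ψ) c

namespace KHom

/-- Composition of Kleisli morphisms, in diagrammatic order. -/
noncomputable def comp {X Y Z : JKGraph.{u}} (φ : KHom X Y) (ψ : KHom Y Z) : KHom X Z where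
  arc a := ψ.arc (φ.arc a)
  arc_inv a := by rw [φ.arc_inv, ψ.arc_inv]
  sub x := (φ.sub x).bind ψ
  compat x h := by
    rw [← φ.compat]
    generalize φ.sub x = c
    induction c using Quotient.inductionOn
    rfl

end KHom

namespace JKGraph

/-- The corolla of `G` at a vertex `x`: one vertex, with half-edges the half-edges of `G` at `x`,
and one port opposite to every half-edge. -/
def corolla (G : JKGraph.{u}) (x : G.V) : JKGraph.{u} where
  A := G.Flag x ⊕ G.Flag x
  H := G.Flag x
  V := PUnit
  finA := by
    have : Finite (G.Flag x) := by have := G.finH; exact inferInstanceAs (Finite {h // _})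
    infer_instance
  finH := by have := G.finH; exact inferInstanceAs (Finite {h // _})
  finV := inferInstance
  inv := Sum.swap
  s := Sum.inl
  p _ := PUnit.unit
  inv_inv := Sum.swap_swap
  inv_ne := by rintro (a | a) e <;> cases e
  s_inj := Sum.inl_injective

/-- The canonical etale morphism from the corolla at `x`. -/
def corollaMap (G : JKGraph.{u}) (x : G.V) : Etale (G.corolla x) G where
  arc := Sum.elim (fun h => G.s h.1) (fun h => G.inv (G.s h.1))
  half h := h.1
  vert _ := x
  arc_inv := by
    rintro (h | h)
    · rfl
    · exact (G.inv_inv _).symm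
  arc_s _ := rfl
  vert_p h := h.2.symm
  pullback _ h' e := ⟨⟨h', e⟩, ⟨rfl, rfl⟩, fun _ y => Subtype.ext y.2⟩

end JKGraph

/-- The corolla at a vertex `x` of `G`, over `G'` by means of an etale morphism `f : G → G'`,
with its ports labelled by the opposite half-edges. -/
def NGraph.corolla {G G' : JKGraph.{u}} (f : Etale G G') (x : G.V) : NGraph (G.Flag x) G' where
  G := G.corolla x
  eff := by
    refine ⟨⟨PUnit.unit⟩, ?_⟩
    rintro (h | h)
    · exact Or.inl ⟨h, rfl⟩
    · exact Or.inr ⟨h, rfl⟩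
  port :=
    { toFun := fun h => ⟨Sum.inr h, by rintro ⟨k, e⟩; cases e⟩
      invFun := fun
        | ⟨Sum.inl h, e⟩ => absurd ⟨h, rfl⟩ e
        | ⟨Sum.inr h, _⟩ => h
      left_inv := fun _ => rfl
      right_inv := fun
        | ⟨Sum.inl h, e⟩ => absurd ⟨h, rfl⟩ e
        | ⟨Sum.inr _, _⟩ => rfl }
  map := (G.corollaMap x).comp f

namespace KHom

/-- The free Kleisli morphism on an etale morphism: every vertex is sent to its corolla. -/
def free {G G' : JKGraph.{u}} (f : Etale G G') : KHom G G' where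
  arc := f.arc
  arc_inv := f.arc_inv
  sub x := Quotient.mk _ (NGraph.corolla f x)
  compat _ _ := rfl

/-- The identity Kleisli morphism (the unit of the monad). -/
def id (G : JKGraph.{u}) : KHom G G := free (Etale.id G)

end KHom

namespace NGraph

theorem bind_corolla {X Y Z : JKGraph.{u}} (f : Etale X Y) (ψ : KHom Y Z) (x : X.V) :
    Rel ((corolla f x).bind ψ) ((ψ.sub (f.vert x)).out.reindex (f.flagEquiv x)) := by
  let Q := (ψ.sub (f.vert x)).out.reindex (f.flagEquiv x)
  let K := (corolla f x).family ψ
  have hK : ∀ h : (corolla f x).G.Flag PUnit.unit,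
      ((K PUnit.unit).port h).1 = (Q.port h.1).1 := fun h => by
    have : (corolla f x).map.flagEquiv PUnit.unit h = f.flagEquiv x h.1 := Subtype.ext rfl
    show ((ψ.sub (f.vert x)).out.port _).1 = ((ψ.sub (f.vert x)).out.port _).1
    rw [this]
  have bQ : ∀ h, Q.map.arc (Q.port h).1 = ψ.arc (f.arc (X.inv (X.s h.1))) := fun h => by
    refine (NClass.boundary_out _ _).trans ((ψ.compat _ _).trans ?_)
    rw [Etale.flagEquiv_val, f.arc_inv, f.arc_s]
  let F : Etale ((corolla f x).bind ψ).G Q.G :=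
    { arc := Sum.elim (Sum.elim (fun h => Q.G.inv (Q.port h).1) (fun h => (Q.port h).1))
        (fun a => a.2.1)
      half := fun k => k.2
      vert := fun y => y.2
      arc_inv := by
        rintro ((h | h) | ⟨_, a, ha⟩)
        · exact (Q.G.inv_inv _).symm
        · rfl
        · rfl
      arc_s := by
        rintro ⟨⟨⟩, k⟩
        rcases JKGraph.half_cases (K := K) PUnit.unit k with ⟨h, hl⟩ | hl
        · have := JKGraph.glue_s_port (K := K) PUnit.unit k h hl
          refine (congrArg _ this).trans ?_
          show Q.G.inv (Q.port h.1).1 = Q.G.s k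
          rw [← hK h, ← hl]
          exact Q.G.inv_inv _
        · have := JKGraph.glue_s_inner (K := K) PUnit.unit k hl
          exact (congrArg _ this).trans rfl
      vert_p := fun _ => rfl
      pullback := by
        rintro ⟨⟨⟩, y⟩ h' e
        refine ⟨⟨PUnit.unit, h'⟩, ⟨congrArg (Sigma.mk PUnit.unit) e, rfl⟩, ?_⟩
        rintro ⟨⟨⟩, k⟩ ⟨_, rfl⟩
        rfl }
  have hp : ∀ k, F.arc (((corolla f x).bind ψ).port k).1 = (Q.port k).1 := fun k => rfl
  refine ⟨F, isInvertible_of _ _ F ⟨?_, fun y => ⟨⟨PUnit.unit, y⟩, rfl⟩⟩ hp, hp, ?_⟩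
  · rintro ⟨⟨⟩, y⟩ ⟨⟨⟩, y'⟩ (rfl : y = y')
    rfl
  · ext z
    · rcases z with (h | h) | ⟨⟨⟩, a⟩
      · show Q.map.arc (Q.G.inv (Q.port h).1) = ψ.arc (f.arc (X.s h.1))
        rw [Q.map.arc_inv, bQ, f.arc_inv, ψ.arc_inv, Z.inv_inv]
      · exact bQ h
      · rfl
    · rfl
    · rfl

/-- In a composite, the chosen representatives of the isomorphism classes of graphs to be
substituted can be replaced by any others. -/
theorem bind_rel_subst {n : Type u} {Y Z : JKGraph.{u}} (P : NGraph n Y) (ψ : KHom Y Z)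
    (K : ∀ x : P.G.V, NGraph (P.G.Flag x) Z) (hK) (θ : ∀ x, Rel (P.family ψ x) (K x)) :
    Rel (P.bind ψ) (P.subst K (fun a => ψ.arc (P.map.arc a))
      (fun a => by rw [P.map.arc_inv, ψ.arc_inv]) hK) :=
  subst_rel (Etale.id _) Function.bijective_id (fun _ => rfl) θ (fun _ => rfl)

theorem bind_id {n : Type u} {Y : JKGraph.{u}} (P : NGraph n Y) : Rel (P.bind (KHom.id Y)) P := by
  let K := fun x : P.G.V =>
    (corolla (Etale.id Y) (P.map.vert x)).reindex (P.map.flagEquiv x)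
  have hK : ∀ (x : P.G.V) (h : P.G.Flag x), (K x).map.arc ((K x).port h).1 =
      P.map.arc (P.G.inv (P.G.s h.1)) := fun x h => by
    rw [P.map.arc_inv, P.map.arc_s]; rfl
  refine Rel.trans (bind_rel_subst P (KHom.id Y) K hK fun x =>
    Rel.reindex _ (Quotient.exact (s := setoid _ _) (Quotient.out_eq _))) ?_
  have no : ∀ (x : P.G.V) (a : {a // (K x).G.IsInner a}), False := by
    rintro x ⟨h | h, h1, h2⟩
    · obtain ⟨_, h2⟩ := h2; cases h2
    · obtain ⟨_, h1⟩ := h1; cases h1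
  let R := P.subst K (fun a => (KHom.id Y).arc (P.map.arc a))
      (fun a => by rw [P.map.arc_inv, (KHom.id Y).arc_inv]) hK
  let F : Etale R.G P.G :=
    { arc := Sum.elim (fun a => a) (fun a => (no _ a.2).elim)
      half := fun k => ((P.map.flagEquiv k.1).symm k.2).1
      vert := fun y => y.1
      arc_inv := by
        rintro (a | ⟨x, a⟩)
        · rfl
        · exact (no _ a).elim
      arc_s := by
        rintro ⟨x, k⟩
        refine (congrArg _ (JKGraph.glue_s_port (K := K) x k ((P.map.flagEquiv x).symm k) ?_)).trans
          rfl
        exact congrArg Sum.inr ((P.map.flagEquiv x).apply_symm_apply k).symm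
      vert_p := fun k => ((P.map.flagEquiv k.1).symm k.2).2.symm
      pullback := by
        rintro ⟨x, ⟨⟩⟩ h' e
        refine ⟨⟨x, P.map.flagEquiv x ⟨h', e⟩⟩, ⟨rfl, ?_⟩, ?_⟩
        · exact congrArg Subtype.val ((P.map.flagEquiv x).symm_apply_apply ⟨h', e⟩)
        · rintro ⟨x', k⟩ ⟨hk, rfl⟩
          obtain ⟨rfl, _⟩ := Sigma.mk.inj hk
          exact congrArg (Sigma.mk x') ((P.map.flagEquiv x').apply_symm_apply k).symm }
  have hp : ∀ k, F.arc (R.port k).1 = (P.port k).1 := fun k => rfl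
  refine ⟨F, isInvertible_of R P F ⟨?_, fun y => ⟨⟨y, PUnit.unit⟩, rfl⟩⟩ hp, hp, ?_⟩
  · rintro ⟨x, ⟨⟩⟩ ⟨x', ⟨⟩⟩ (rfl : x = x')
    rfl
  · ext z
    · rcases z with a | ⟨x, a⟩
      · rfl
      · exact (no _ a).elim
    · exact congrArg Subtype.val ((P.map.flagEquiv z.1).apply_symm_apply z.2)
    · rfl

theorem bind_bind {n : Type u} {X Y Z : JKGraph.{u}} (P : NGraph n X) (ψ : KHom X Y)
    (χ : KHom Y Z) : Rel ((P.bind ψ).bind χ) (P.bind (ψ.comp χ)) := by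
  let K := P.family ψ
  let M := fun x : P.G.V => (K x).bind χ
  have hM : ∀ (x : P.G.V) (h : P.G.Flag x), (M x).map.arc ((M x).port h).1 =
      χ.arc (ψ.arc (P.map.arc (P.G.inv (P.G.s h.1)))) := fun x h => by
    refine congrArg χ.arc ((NClass.boundary_out _ _).trans ((ψ.compat _ _).trans ?_))
    rw [Etale.flagEquiv_val, P.map.arc_inv, P.map.arc_s]
  refine Rel.trans ?_ (Rel.symm (bind_rel_subst P (ψ.comp χ) M hM fun x =>
    Rel.reindex (P.map.flagEquiv x) (Quotient.exact (s := setoid _ _) ((Quotient.out_eq _).trans ?_))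
      (Q := (ψ.sub (P.map.vert x)).out.bind χ)))
  swap
  · show NClass.bind (ψ.sub _) χ = _
    conv_lhs => rw [← Quotient.out_eq (ψ.sub (P.map.vert x))]
    rfl
  let L := (P.bind ψ).family χ
  let R := P.subst M (fun a => (ψ.comp χ).arc (P.map.arc a))
      (fun a => by rw [P.map.arc_inv, (ψ.comp χ).arc_inv]) hM
  let F : Etale ((P.bind ψ).bind χ).G R.G :=
    { arc := Sum.elim
        (Sum.elim Sum.inl (fun a => Sum.inr ⟨a.1, Sum.inl a.2.1, by
          obtain ⟨x, a, ⟨k, rfl⟩, l, hl⟩ := a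
          refine ⟨JKGraph.glue_inl_mem k, ?_⟩
          have := JKGraph.glue_inl_mem (G := (K x).G) (K := (K x).family χ) l
          rw [hl] at this
          exact this⟩))
        (fun b => Sum.inr ⟨b.1.1, Sum.inr ⟨b.1.2, b.2⟩,
          JKGraph.glue_inr_mem (G := (K b.1.1).G) (K := (K b.1.1).family χ) _,
          JKGraph.glue_inr_mem (G := (K b.1.1).G) (K := (K b.1.1).family χ) _⟩)
      half := fun l => ⟨l.1.1, l.1.2, l.2⟩
      vert := fun z => ⟨z.1.1, z.1.2, z.2⟩
      arc_inv := by rintro ((a | a) | b) <;> rfl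
      arc_s := by
        rintro ⟨⟨x, y⟩, l⟩
        rcases JKGraph.half_cases (K := L) (⟨x, y⟩ : (P.bind ψ).G.V) l with ⟨⟨⟨x', k⟩, h⟩, hl⟩ | hl
        · refine (congrArg _ (JKGraph.glue_s_port (K := L) _ l _ hl)).trans ?_
          obtain ⟨rfl, h'⟩ := Sigma.mk.inj h
          have h' := eq_of_heq h'
          subst h'
          have e2 : ((K x').family χ ((K x').G.p k)).G.inv (((K x').family χ ((K x').G.p k)).G.s l)
              = (((K x').family χ ((K x').G.p k)).port ⟨k, rfl⟩).1 := hl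
          have e3 := JKGraph.glue_s_port (K := (K x').family χ) _ l _ e2
          rcases JKGraph.half_cases (K := K) x' k with ⟨h2, hk⟩ | hk
          · refine (congrArg _ (congrArg Sum.inl (JKGraph.glue_s_port (K := K) x' k h2 hk))).trans ?_
            refine Eq.trans ?_ (JKGraph.glue_s_port (K := M) x' ⟨(K x').G.p k, l⟩ h2 ?_).symm
            · rfl
            · refine (congrArg ((M x').G.inv) e3).trans ?_
              exact congrArg Sum.inl hk
          · refine (congrArg _ (congrArg Sum.inl (JKGraph.glue_s_inner (K := K) x' k hk))).trans ?_
            have hk2 : (M x').G.inv ((M x').G.s ⟨(K x').G.p k, l⟩) ∈ Set.range (M x').G.s := by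
              obtain ⟨m, hm⟩ := hk
              have := JKGraph.glue_inl_mem (G := (K x').G) (K := (K x').family χ) m
              rw [hm] at this
              have e4 := congrArg ((M x').G.inv) e3
              exact e4 ▸ this
            refine Eq.trans ?_ (JKGraph.glue_s_inner (K := M) x' ⟨(K x').G.p k, l⟩ hk2).symm
            exact congrArg Sum.inr (congrArg (Sigma.mk x') (Subtype.ext e3.symm))
        · refine (congrArg _ (JKGraph.glue_s_inner (K := L) _ l hl)).trans ?_
          have e3 := JKGraph.glue_s_inner (K := (K x).family χ) y l hl
          have hk2 : (M x).G.inv ((M x).G.s ⟨y, l⟩) ∈ Set.range (M x).G.s := by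
            have e4 := congrArg ((M x).G.inv) e3
            exact e4 ▸ JKGraph.glue_inr_mem (G := (K x).G) (K := (K x).family χ) _
          refine Eq.trans ?_ (JKGraph.glue_s_inner (K := M) x ⟨y, l⟩ hk2).symm
          exact congrArg Sum.inr (congrArg (Sigma.mk x) (Subtype.ext e3.symm))
      vert_p := fun _ => rfl
      pullback := by
        rintro ⟨⟨x, y⟩, z⟩ ⟨x', y', l⟩ e
        obtain ⟨rfl, e⟩ := Sigma.mk.inj e
        obtain ⟨rfl, e⟩ := Sigma.mk.inj (eq_of_heq e)
        refine ⟨⟨⟨x', y'⟩, l⟩, ⟨congrArg (Sigma.mk _) (eq_of_heq e), rfl⟩, ?_⟩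
        rintro ⟨⟨x, y⟩, k⟩ ⟨_, h⟩
        obtain ⟨rfl, h⟩ := Sigma.mk.inj h
        obtain ⟨rfl, h⟩ := Sigma.mk.inj (eq_of_heq h)
        exact congrArg (Sigma.mk _) (eq_of_heq h) }
  have hp : ∀ k, F.arc (((P.bind ψ).bind χ).port k).1 = (R.port k).1 := fun k => rfl
  refine ⟨F, isInvertible_of _ R F ⟨?_, fun z => ⟨⟨⟨z.1, z.2.1⟩, z.2.2⟩, rfl⟩⟩ hp, hp, ?_⟩
  · rintro ⟨⟨x, y⟩, z⟩ ⟨⟨x', y'⟩, z'⟩ h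
    obtain ⟨rfl, h⟩ := Sigma.mk.inj h
    obtain ⟨rfl, h⟩ := Sigma.mk.inj (eq_of_heq h)
    exact congrArg (Sigma.mk _) (eq_of_heq h)
  · ext z
    · rcases z with (a | a) | b <;> rfl
    · rfl
    · rfl

end NGraph

namespace KHom

theorem id_comp {X Y : JKGraph.{u}} (φ : KHom X Y) : (KHom.id X).comp φ = φ := by
  ext x
  · rfl
  · refine (Quotient.sound (NGraph.bind_corolla (Etale.id X) φ x)).trans ?_
    have : (φ.sub x).out.reindex ((Etale.id X).flagEquiv x) = (φ.sub x).out := by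
      have : (Etale.id X).flagEquiv x = Equiv.refl (X.Flag x) := Equiv.ext fun _ => rfl
      rw [this]; rfl
    exact (congrArg (Quotient.mk _) this).trans (Quotient.out_eq _)

theorem comp_id {X Y : JKGraph.{u}} (φ : KHom X Y) : φ.comp (KHom.id Y) = φ := by
  ext x
  · rfl
  · show NClass.bind (φ.sub x) (KHom.id Y) = φ.sub x
    generalize φ.sub x = c
    induction c using Quotient.inductionOn with
    | h P => exact Quotient.sound (NGraph.bind_id P)

theorem assoc {W X Y Z : JKGraph.{u}} (φ : KHom W X) (ψ : KHom X Y) (χ : KHom Y Z) :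
    (φ.comp ψ).comp χ = φ.comp (ψ.comp χ) := by
  ext x
  · rfl
  · show NClass.bind (NClass.bind (φ.sub x) ψ) χ = NClass.bind (φ.sub x) (ψ.comp χ)
    generalize φ.sub x = c
    induction c using Quotient.inductionOn with
    | h P => exact Quotient.sound (NGraph.bind_bind P ψ χ)

/-- The graph obtained by gluing the graphs assigned to the vertices of `R`, according to the
recipe that assembles `R` from its vertices and edges. -/
noncomputable def colimitGraph {R Y : JKGraph.{u}} (φ : KHom R Y) : JKGraph.{u} :=
  R.glue (fun x => (φ.sub x).out)

/-- The etale morphism to `Y` from the colimit graph of a Kleisli morphism. -/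
noncomputable def colimitMap {R Y : JKGraph.{u}} (φ : KHom R Y) : Etale φ.colimitGraph Y :=
  R.glueMap (fun x => (φ.sub x).out) φ.arc φ.arc_inv
    (fun x h => (NClass.boundary_out _ _).trans (φ.compat x h))

/-- A Kleisli morphism `R → Y` is generic if its colimit graph is isomorphic to `Y`. -/
def IsGeneric {R Y : JKGraph.{u}} (φ : KHom R Y) : Prop := φ.colimitMap.IsInvertible

end KHom

/-- The objects of the restricted Kleisli category: graphs without isolated edges. -/
structure KleisliGraph : Type (u + 1) where
  graph : JKGraph.{u}
  noIsolatedEdges : graph.NoIsolatedEdges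

/-- The restricted Kleisli category. -/
noncomputable instance : Category.{u + 1} KleisliGraph.{u} where
  Hom R Y := KHom R.graph Y.graph
  id R := KHom.id R.graph
  comp φ ψ := KHom.comp φ ψ
  id_comp := KHom.id_comp
  comp_id := KHom.comp_id
  assoc := KHom.assoc

/-- The reduced covers, as morphisms of the restricted Kleisli category. -/
def reducedCovers : MorphismProperty KleisliGraph.{u} := fun R Y φ =>
  ∃ f : Etale R.graph Y.graph, f.IsReducedCover ∧ φ = KHom.free f

/-- The generic morphisms of the restricted Kleisli category. -/
def genericMorphisms : MorphismProperty KleisliGraph.{u} := fun R Y φ =>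
  KHom.IsGeneric (R := R.graph) (Y := Y.graph) φ

section Cospans

variable {C : Type u} [Category.{v} C]

/-- Two classes of morphisms suitable for forming a category of cospans: both contain the
isomorphisms and are closed under composition, and they admit pushouts along each other, the
resulting two new morphisms being again in the same classes. -/
structure CospanClasses (E M : MorphismProperty C) : Prop where
  iso_left : ∀ {X Y : C} (f : X ⟶ Y), IsIso f → E f
  iso_right : ∀ {X Y : C} (f : X ⟶ Y), IsIso f → M f
  comp_left : ∀ {X Y Z : C} (f : X ⟶ Y) (g : Y ⟶ Z), E f → E g → E (f ≫ g)
  comp_right : ∀ {X Y Z : C} (f : X ⟶ Y) (g : Y ⟶ Z), M f → M g → M (f ≫ g)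
  pushout : ∀ {R R' S : C} (g : R ⟶ S) (r : R ⟶ R'), M g → E r →
    ∃ (S' : C) (r' : S ⟶ S') (g' : R' ⟶ S'), IsPushout g r r' g' ∧ E r' ∧ M g'

/-- A cospan `T → S ← R` with first leg in `E` and second leg in `M`. -/
structure ECospan (E M : MorphismProperty C) (T R : C) where
  apex : C
  fst : T ⟶ apex
  snd : R ⟶ apex
  fst_mem : E fst
  snd_mem : M snd

/-- Isomorphism of cospans. -/
instance ECospan.setoid (E M : MorphismProperty C) (T R : C) : Setoid (ECospan E M T R) where
  r c d := ∃ e : c.apex ≅ d.apex, c.fst ≫ e.hom = d.fst ∧ c.snd ≫ e.hom = d.snd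
  iseqv :=
    { refl := fun _ => ⟨Iso.refl _, by simp, by simp⟩
      symm := by
        rintro c d ⟨e, h1, h2⟩
        exact ⟨e.symm, by simp [← h1], by simp [← h2]⟩
      trans := by
        rintro c d d' ⟨e, h1, h2⟩ ⟨e', h1', h2'⟩
        exact ⟨e ≪≫ e', by simp [← h1', ← h1], by simp [← h2', ← h2]⟩ }

/-- Isomorphism classes of cospans. -/
def CospanClass (E M : MorphismProperty C) (T R : C) := Quotient (ECospan.setoid E M T R)

variable {E M : MorphismProperty C}

/-- The isomorphism class of the cospan with legs `f` and `g`. -/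
def CospanClass.mk {T S R : C} (f : T ⟶ S) (g : R ⟶ S) (hf : E f) (hg : M g) :
    CospanClass E M T R :=
  Quotient.mk _ ⟨S, f, g, hf, hg⟩

theorem CospanClass.mk_eq {T S S' R : C} {f : T ⟶ S} {g : R ⟶ S} {f' : T ⟶ S'} {g' : R ⟶ S'}
    {hf : E f} {hg : M g} {hf' : E f'} {hg' : M g'} (e : S ≅ S') (h1 : f ≫ e.hom = f')
    (h2 : g ≫ e.hom = g') : CospanClass.mk f g hf hg = CospanClass.mk f' g' hf' hg' :=
  Quotient.sound ⟨e, h1, h2⟩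

namespace CospanClasses

/-- The composite of two cospans, by means of a chosen pushout. -/
noncomputable def compAux (h : CospanClasses E M) {X Y Z : C} (c : ECospan E M X Y)
    (d : ECospan E M Y Z) : CospanClass E M X Z :=
  let p := h.pushout c.snd d.fst c.snd_mem d.fst_mem
  CospanClass.mk (c.fst ≫ p.choose_spec.choose) (d.snd ≫ p.choose_spec.choose_spec.choose)
    (h.comp_left _ _ c.fst_mem p.choose_spec.choose_spec.choose_spec.2.1)
    (h.comp_right _ _ d.snd_mem p.choose_spec.choose_spec.choose_spec.2.2)

/-- The composite can be computed by any pushout. -/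
theorem compAux_eq (h : CospanClasses E M) {X Y Z : C} (c : ECospan E M X Y)
    (d : ECospan E M Y Z) {P : C} {i : c.apex ⟶ P} {j : d.apex ⟶ P}
    (sq : IsPushout c.snd d.fst i j) (hi : E i) (hj : M j) :
    h.compAux c d = CospanClass.mk (c.fst ≫ i) (d.snd ≫ j) (h.comp_left _ _ c.fst_mem hi)
      (h.comp_right _ _ d.snd_mem hj) := by
  have sq' := (h.pushout c.snd d.fst c.snd_mem d.fst_mem).choose_spec.choose_spec.choose_spec.1
  exact CospanClass.mk_eq (sq'.isoIsPushout _ _ sq) (by simp) (by simp)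

/-- Composition of isomorphism classes of cospans, by pushout. -/
noncomputable def comp (h : CospanClasses E M) {X Y Z : C} (c : CospanClass E M X Y)
    (d : CospanClass E M Y Z) : CospanClass E M X Z :=
  Quotient.lift₂ h.compAux (by
    rintro c d c' d' ⟨e, h1, h2⟩ ⟨e', h1', h2'⟩
    obtain ⟨P, i, j, sq, hi, hj⟩ := h.pushout c.snd d.fst c.snd_mem d.fst_mem
    have sq' : IsPushout c'.snd d'.fst (e.inv ≫ i) (e'.inv ≫ j) :=
      sq.of_iso (Iso.refl _) e e' (Iso.refl _) (by simp [h2]) (by simp [h1']) (by simp) (by simp)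
    rw [h.compAux_eq c d sq hi hj, h.compAux_eq c' d' sq'
      (h.comp_left _ _ (h.iso_left _ inferInstance) hi)
      (h.comp_right _ _ (h.iso_right _ inferInstance) hj)]
    exact CospanClass.mk_eq (Iso.refl _) (by simp [← h1]) (by simp [← h2'])) c d

theorem comp_mk (h : CospanClasses E M) {X Y Z S S' P : C} {f : X ⟶ S} {g : Y ⟶ S} {f' : Y ⟶ S'}
    {g' : Z ⟶ S'} {hf : E f} {hg : M g} {hf' : E f'} {hg' : M g'} {i : S ⟶ P} {j : S' ⟶ P}
    (sq : IsPushout g f' i j) (hi : E i) (hj : M j) :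
    h.comp (CospanClass.mk f g hf hg) (CospanClass.mk f' g' hf' hg') =
      CospanClass.mk (f ≫ i) (g' ≫ j) (h.comp_left _ _ hf hi) (h.comp_right _ _ hg' hj) :=
  h.compAux_eq ⟨S, f, g, hf, hg⟩ ⟨S', f', g', hf', hg'⟩ sq hi hj

end CospanClasses

/-- The category of cospans: the same objects as `C`, and as morphisms the isomorphism classes of
cospans with first leg in `E` and second leg in `M`, composed by pushout. -/
structure CospanCategory (h : CospanClasses E M) where
  obj : C

noncomputable instance (h : CospanClasses E M) : Category.{max u v} (CospanCategory h) where
  Hom T R := CospanClass E M T.obj R.obj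
  id T := CospanClass.mk (𝟙 T.obj) (𝟙 T.obj) (h.iso_left _ inferInstance)
    (h.iso_right _ inferInstance)
  comp c d := h.comp c d
  id_comp c := by
    induction c using Quotient.inductionOn with
    | h c =>
      refine (h.comp_mk (IsPushout.of_id_fst (f := c.fst)) c.fst_mem
        (h.iso_right _ inferInstance)).trans ?_
      exact CospanClass.mk_eq (Iso.refl _) (by simp) (by simp)
  comp_id c := by
    induction c using Quotient.inductionOn with
    | h c =>
      refine (h.comp_mk (IsPushout.of_id_snd (f := c.snd)) (h.iso_left _ inferInstance)
        c.snd_mem).trans ?_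
      exact CospanClass.mk_eq (Iso.refl _) (by simp) (by simp)
  assoc c c' c'' := by
    induction c using Quotient.inductionOn with | h c => ?_
    induction c' using Quotient.inductionOn with | h c' => ?_
    induction c'' using Quotient.inductionOn with | h c'' => ?_
    obtain ⟨P, i, j, sq, hi, hj⟩ := h.pushout c.snd c'.fst c.snd_mem c'.fst_mem
    obtain ⟨P', i', j', sq', hi', hj'⟩ := h.pushout c'.snd c''.fst c'.snd_mem c''.fst_mem
    obtain ⟨Q, k, l, sq'', hk, hl⟩ := h.pushout j i' hj hi'
    have e1 := h.comp_mk (f := c.fst) (g' := c'.snd) (hf := c.fst_mem) (hg' := c'.snd_mem)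
      (hg := c.snd_mem) (hf' := c'.fst_mem) sq hi hj
    have e2 := h.comp_mk (f := c'.fst) (g' := c''.snd) (hf := c'.fst_mem) (hg' := c''.snd_mem)
      (hg := c'.snd_mem) (hf' := c''.fst_mem) sq' hi' hj'
    have sqa : IsPushout (c'.snd ≫ j) c''.fst k (j' ≫ l) := (sq'.flip.paste_vert sq''.flip).flip
    have sqb : IsPushout c.snd (c'.fst ≫ i') (i ≫ k) l := sq.paste_vert sq''
    refine (congrArg (fun t => h.comp t (Quotient.mk _ c'')) e1).trans ?_
    refine Eq.trans ?_ (congrArg (fun t => h.comp (Quotient.mk _ c) t) e2).symm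
    refine (h.comp_mk sqa hk (h.comp_right _ _ hj' hl)).trans ?_
    refine Eq.trans ?_ (h.comp_mk sqb (h.comp_left _ _ hi hk) hl).symm
    exact CospanClass.mk_eq (Iso.refl _) (by simp) (by simp)

/-- The cospans `r / identity` with `r` in `E` (up to isomorphism of cospans). -/
def leftCospans (h : CospanClasses E M) : MorphismProperty (CospanCategory h) := fun T R c =>
  ∃ (r : T.obj ⟶ R.obj) (hr : E r), c = CospanClass.mk r (𝟙 R.obj) hr (h.iso_right _ inferInstance)

/-- The cospans `identity / g` with `g` in `M` (up to isomorphism of cospans). -/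
def rightCospans (h : CospanClasses E M) : MorphismProperty (CospanCategory h) := fun T R c =>
  ∃ (g : R.obj ⟶ T.obj) (hg : M g), c = CospanClass.mk (𝟙 T.obj) g (h.iso_left _ inferInstance) hg

end Cospans

/-- A pair of classes of morphisms is a factorisation system if both classes contain the
isomorphisms and are closed under composition, and every morphism factors as a morphism of the
first class followed by a morphism of the second class, uniquely up to unique comparison
isomorphism. -/
structure IsFactorisationSystem {C : Type u} [Category.{v} C] (L R : MorphismProperty C) :
    Prop where
  iso_left : ∀ {X Y : C} (f : X ⟶ Y), IsIso f → L f
  iso_right : ∀ {X Y : C} (f : X ⟶ Y), IsIso f → R f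
  comp_left : ∀ {X Y Z : C} (f : X ⟶ Y) (g : Y ⟶ Z), L f → L g → L (f ≫ g)
  comp_right : ∀ {X Y Z : C} (f : X ⟶ Y) (g : Y ⟶ Z), R f → R g → R (f ≫ g)
  exists_factorisation : ∀ {X Y : C} (f : X ⟶ Y),
    ∃ (Z : C) (l : X ⟶ Z) (r : Z ⟶ Y), L l ∧ R r ∧ l ≫ r = f
  unique_comparison : ∀ {X Y Z Z' : C} (l : X ⟶ Z) (r : Z ⟶ Y) (l' : X ⟶ Z') (r' : Z' ⟶ Y),
    L l → R r → L l' → R r' → l ≫ r = l' ≫ r' →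
      ∃! e : Z ≅ Z', l ≫ e.hom = l' ∧ e.hom ≫ r' = r

/-!
Between graphs without isolated edges, a reduced cover is the same as an etale morphism that is
bijective on vertices: keeping one vertex in each fibre of a cover, together with all arcs, still
gives a cover. Such a morphism is surjective on arcs, so its free Kleisli morphism determines
whatever is composed with it, and is an epimorphism. Likewise a Kleisli morphism is generic if and
only if its colimit map is bijective on vertices and it sends ports to ports.

For the pushout of a generic `g : R → S` along a reduced cover `r : R → R'`, relabel along `r` the
graphs that `g` substitutes into the vertices of `R`, and glue them according to `R'`. The induced
`S → S'` is bijective on vertices, hence an epimorphism, and it identifies distinct arcs only if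
they come from arcs of `R` identified by `r`; any cocone therefore descends along it.

If a composite of Kleisli morphisms is free, then so is the first one, because a substitution
yields a corolla only when applied to a corolla. Hence a generic morphism is invertible as soon as
some composite with it in first place is. An invertible cospan then has invertible legs: the first
leg is a split monomorphism and an epimorphism, the second is generic with an invertible composite.
The factorisations `T → S = S`, `S = S ← R` are thus unique up to unique isomorphism.
-/

namespace Etale

variable {G G' G'' : JKGraph.{u}}

theorem half_injective (f : Etale G G') (hv : Function.Injective f.vert) :
    Function.Injective f.half := by
  intro h k e
  have hp : G.p h = G.p k := hv (by rw [f.vert_p, f.vert_p, e])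
  exact (f.pullback (G.p k) (f.half k) (f.vert_p k).symm).unique ⟨hp, e⟩ ⟨rfl, rfl⟩

theorem half_surjective (f : Etale G G') (hv : Function.Surjective f.vert) :
    Function.Surjective f.half := by
  intro h'
  obtain ⟨x, hx⟩ := hv (G'.p h')
  obtain ⟨h, ⟨-, hh⟩, -⟩ := f.pullback x h' hx.symm
  exact ⟨h, hh⟩

theorem arc_surjective (f : Etale G G') (hv : Function.Surjective f.vert)
    (hG' : G'.NoIsolatedEdges) : Function.Surjective f.arc := by
  intro a
  rcases hG' a with ⟨h', rfl⟩ | ⟨h', e⟩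
  · obtain ⟨h, rfl⟩ := f.half_surjective hv h'
    exact ⟨G.s h, f.arc_s h⟩
  · obtain ⟨h, rfl⟩ := f.half_surjective hv h'
    exact ⟨G.inv (G.s h), by rw [f.arc_inv, f.arc_s, e, G'.inv_inv]⟩

theorem arc_injOn_range_s (f : Etale G G') (hv : Function.Injective f.vert) :
    Set.InjOn f.arc (Set.range G.s) := by
  rintro _ ⟨h, rfl⟩ _ ⟨k, rfl⟩ e
  rw [f.arc_s, f.arc_s] at e
  rw [f.half_injective hv (G'.s_inj e)]

theorem eq_of_inv_mem_range_s (f : Etale G G') (hv : Function.Injective f.vert) {a b : G.A}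
    (ha : G.inv a ∈ Set.range G.s) (hb : G.inv b ∈ Set.range G.s) (e : f.arc a = f.arc b) :
    a = b := by
  have h : G.inv a = G.inv b := f.arc_injOn_range_s hv ha hb (by rw [f.arc_inv, f.arc_inv, e])
  rw [← G.inv_inv a, h, G.inv_inv]

theorem isInner_arc (f : Etale G G') {a : G.A} (ha : G.IsInner a) : G'.IsInner (f.arc a) := by
  obtain ⟨⟨h, hh⟩, k, hk⟩ := ha
  exact ⟨⟨f.half h, by rw [← f.arc_s, hh]⟩, f.half k, by rw [← f.arc_s, hk, f.arc_inv]⟩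

theorem arc_eq_of_isInner (f : Etale G G') (hv : Function.Injective f.vert)
    (hG : G.NoIsolatedEdges) {a b : G.A} (ha : G.IsInner a) (e : f.arc a = f.arc b) : a = b :=
  (hG b).elim (fun hb => f.arc_injOn_range_s hv ha.1 hb e)
    (fun hb => f.eq_of_inv_mem_range_s hv ha.2 hb e)

theorem IsInvertible.isPort_arc {f : Etale G G'} (hf : f.IsInvertible) {a : G.A}
    (ha : G.IsPort a) : G'.IsPort (f.arc a) := by
  rintro ⟨h', e⟩
  obtain ⟨h, rfl⟩ := hf.2.1.2 h'
  exact ha ⟨h, hf.1.1 ((f.arc_s h).trans e)⟩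

theorem isInvertible_of_isPort_arc (f : Etale G G') (hG : G.NoIsolatedEdges)
    (hG' : G'.NoIsolatedEdges) (hv : Function.Bijective f.vert)
    (hp : ∀ a, G.IsPort a → G'.IsPort (f.arc a)) : f.IsInvertible := by
  have mem_iff (a : G.A) : f.arc a ∈ Set.range G'.s ↔ a ∈ Set.range G.s :=
    ⟨not_imp_not.1 (hp a), fun ⟨h, hh⟩ => ⟨f.half h, by rw [← f.arc_s, hh]⟩⟩
  refine ⟨⟨fun a b e => ?_, f.arc_surjective hv.2 hG'⟩,
    ⟨f.half_injective hv.1, f.half_surjective hv.2⟩, hv⟩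
  rcases hG a with ha | ha
  · exact f.arc_injOn_range_s hv.1 ha ((mem_iff b).1 (e ▸ (mem_iff a).2 ha)) e
  · have hb : G.inv b ∈ Set.range G.s := by
      rw [← mem_iff, f.arc_inv, ← e, ← f.arc_inv]
      exact (mem_iff _).2 ha
    exact f.eq_of_inv_mem_range_s hv.1 ha hb e

theorem IsInvertible.exists_inverse {f : Etale G G'} (hf : f.IsInvertible) :
    ∃ g : Etale G' G, f.comp g = Etale.id G ∧ g.comp f = Etale.id G' := by
  obtain ⟨arc, arc_left, arc_right⟩ := Function.bijective_iff_has_inverse.1 hf.1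
  obtain ⟨half, half_left, half_right⟩ := Function.bijective_iff_has_inverse.1 hf.2.1
  obtain ⟨vert, vert_left, vert_right⟩ := Function.bijective_iff_has_inverse.1 hf.2.2
  refine ⟨
    { arc := arc
      half := half
      vert := vert
      arc_inv := fun a => hf.1.1 (by rw [f.arc_inv, arc_right, arc_right])
      arc_s := fun h => hf.1.1 (by rw [f.arc_s, arc_right, half_right])
      vert_p := fun h => hf.2.2.1 (by rw [f.vert_p, vert_right, half_right])
      pullback := fun x h hx => ⟨f.half h, ⟨by rw [← f.vert_p, hx, vert_right], half_left h⟩,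
        fun k hk => by rw [← hk.2, half_right]⟩ }, ?_, ?_⟩
  · ext t
    exacts [arc_left t, half_left t, vert_left t]
  · ext t
    exacts [arc_right t, half_right t, vert_right t]

theorem isInvertible_of_inverse {f : Etale G G'} {g : Etale G' G} (hfg : f.comp g = Etale.id G)
    (hgf : g.comp f = Etale.id G') : f.IsInvertible := by
  simp only [Etale.ext_iff, funext_iff] at hfg hgf
  exact ⟨Function.bijective_iff_has_inverse.2 ⟨g.arc, hfg.1, hgf.1⟩,
    Function.bijective_iff_has_inverse.2 ⟨g.half, hfg.2.1, hgf.2.1⟩,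
    Function.bijective_iff_has_inverse.2 ⟨g.vert, hfg.2.2, hgf.2.2⟩⟩

theorem IsReducedCover.vert_injective {f : Etale G G'} (hf : f.IsReducedCover) :
    Function.Injective f.vert := by
  obtain ⟨ha, hv, hU⟩ := hf
  -- Keeping all arcs but only one vertex in each fibre still gives a cover.
  let U : OpenSubgraph G :=
    ⟨Set.univ, Set.range (Function.surjInv hv), fun _ _ => trivial, fun _ _ => trivial⟩
  have hU_verts : f.vert '' U.verts = Set.univ :=
    Set.eq_univ_of_forall fun y => ⟨_, ⟨y, rfl⟩, Function.surjInv_eq hv y⟩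
  have hsurj : Function.Surjective (Function.surjInv hv) :=
    Set.range_eq_univ.1 (hU U (by rw [Set.image_univ, ha.range_eq]) hU_verts).2
  exact ((Function.rightInverse_surjInv hv).rightInverse_of_surjective hsurj).injective

theorem isReducedCover_iff (f : Etale G G') (hG : G.NoIsolatedEdges) (hG' : G'.NoIsolatedEdges) :
    f.IsReducedCover ↔ Function.Bijective f.vert := by
  refine ⟨fun hf => ⟨hf.vert_injective, hf.2.1⟩, fun hv =>
    ⟨f.arc_surjective hv.2 hG', hv.2, fun U _ hU => ?_⟩⟩
  have verts_eq : U.verts = Set.univ :=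
    Set.image_injective.2 hv.1 (hU.trans (Set.image_univ_of_surjective hv.2).symm)
  have s_mem (h : G.H) : G.s h ∈ U.arcs := U.s_mem h (verts_eq ▸ trivial)
  refine ⟨Set.eq_univ_of_forall fun a => ?_, verts_eq⟩
  rcases hG a with ⟨h, rfl⟩ | ⟨h, e⟩
  · exact s_mem h
  · rw [← G.inv_inv a, ← e]
    exact U.inv_mem _ (s_mem h)

/-- The etale morphism determined by its maps on arcs and vertices and by its bijections between
the half-edges at each vertex and those at its image. -/
def ofFlagEquiv (arc : G.A → G'.A) (arc_inv : ∀ a, arc (G.inv a) = G'.inv (arc a))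
    (vert : G.V → G'.V) (flag : ∀ x, G.Flag x ≃ G'.Flag (vert x))
    (arc_s : ∀ x (h : G.Flag x), arc (G.s h.1) = G'.s (flag x h).1) : Etale G G' where
  arc := arc
  half h := (flag (G.p h) ⟨h, rfl⟩).1
  vert := vert
  arc_inv := arc_inv
  arc_s h := arc_s _ ⟨h, rfl⟩
  vert_p h := (flag (G.p h) ⟨h, rfl⟩).2.symm
  pullback x h' hx := by
    obtain ⟨⟨h, rfl⟩, hh⟩ := (flag x).surjective ⟨h', hx⟩
    refine ⟨h, ⟨rfl, congrArg Subtype.val hh⟩, fun k ⟨hk, hk'⟩ => ?_⟩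
    have flag_eq : (flag (G.p k) ⟨k, rfl⟩).1 = (flag (G.p h) ⟨k, hk⟩).1 := by
      generalize G.p h = x at hk
      subst hk
      rfl
    have e : flag (G.p h) ⟨k, hk⟩ = flag (G.p h) ⟨h, rfl⟩ :=
      Subtype.ext (flag_eq.symm.trans (hk'.trans (congrArg Subtype.val hh).symm))
    exact congrArg Subtype.val ((flag (G.p h)).injective e)

theorem flagEquiv_ofFlagEquiv {arc : G.A → G'.A} {arc_inv} {vert : G.V → G'.V}
    {flag : ∀ x, G.Flag x ≃ G'.Flag (vert x)} {arc_s} (x : G.V) :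
    (ofFlagEquiv arc arc_inv vert flag arc_s).flagEquiv x = flag x := by
  ext ⟨h, rfl⟩
  rfl

theorem flagEquiv_comp (f : Etale G G') (g : Etale G' G'') (x : G.V) :
    (f.comp g).flagEquiv x = (f.flagEquiv x).trans (g.flagEquiv (f.vert x)) :=
  Equiv.ext fun _ => rfl

end Etale

namespace JKGraph

variable {G Z : JKGraph.{u}} {K : ∀ x : G.V, NGraph (G.Flag x) Z}

theorem glue_inl_isInner {a : G.A} (ha : G.IsInner a) : (G.glue K).IsInner (Sum.inl a) :=
  ⟨not_not.1 (mt (glue_inl_isPort a).1 (not_not.2 ha.1)),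
    not_not.1 (mt (glue_inl_isPort (G.inv a)).1 (not_not.2 ha.2))⟩

theorem glue_inr_isInner (a : Σ x : G.V, {a : (K x).G.A // (K x).G.IsInner a}) :
    (G.glue K).IsInner (Sum.inr a) :=
  ⟨glue_inr_mem a, glue_inr_mem _⟩

theorem eq_or_inl_of_glue_arc_eq {W : JKGraph.{u}} (F : Etale (G.glue K) W)
    (hF : Function.Injective F.vert) (hG : G.NoIsolatedEdges) {a b : (G.glue K).A}
    (e : F.arc a = F.arc b) : a = b ∨ ∃ a' b', a = Sum.inl a' ∧ b = Sum.inl b' := by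
  have hglue : (G.glue K).NoIsolatedEdges := glue_noIsolatedEdges hG
  rcases a with a | a
  · rcases b with b | b
    · exact Or.inr ⟨a, b, rfl, rfl⟩
    · exact Or.inl (F.arc_eq_of_isInner hF hglue (glue_inr_isInner b) e.symm).symm
  · exact Or.inl (F.arc_eq_of_isInner hF hglue (glue_inr_isInner a) e)

end JKGraph

namespace NGraph

variable {n : Type u} {Y Z : JKGraph.{u}}

theorem out_rel (P : NGraph n Y) : Rel (Quotient.mk (setoid n Y) P).out P :=
  Quotient.exact (s := setoid n Y) (Quotient.out_eq _)

theorem corolla_rel (f : Etale Y Z) (x : Y.V) :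
    Rel (corolla f x) ((corolla (Etale.id Z) (f.vert x)).reindex (f.flagEquiv x)) :=
  -- Both sides compute the substitution of the identity of `Z` into the corolla.
  (bind_id _).symm.trans <| (bind_corolla f (KHom.id Z) x).trans <|
    Rel.reindex _ (out_rel (corolla (Etale.id Z) (f.vert x)))

/-- The corollas among the `n`-graphs: one vertex and no inner edge. An `n`-graph is effective,
hence has a vertex, so it is enough to ask for at most one. -/
def IsCorolla (P : NGraph n Y) : Prop := Subsingleton P.G.V ∧ ∀ a, ¬ P.G.IsInner a

theorem isCorolla_corolla (f : Etale Y Z) (x : Y.V) : (corolla f x).IsCorolla :=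
  ⟨inferInstanceAs (Subsingleton PUnit), by rintro _ ⟨⟨h, rfl⟩, k, hk⟩; cases hk⟩

theorem IsCorolla.of_rel {P Q : NGraph n Y} (hQ : Q.IsCorolla) (r : Rel P Q) : P.IsCorolla := by
  obtain ⟨e, he, -⟩ := r
  have := hQ.1
  exact ⟨he.2.2.1.subsingleton, fun a ha => hQ.2 _ (e.isInner_arc ha)⟩

theorem IsCorolla.of_bind {P : NGraph n Y} {ψ : KHom Y Z} (h : (P.bind ψ).IsCorolla) :
    P.IsCorolla := by
  refine ⟨⟨fun x y => ?_⟩, fun a ha => h.2 _ (JKGraph.glue_inl_isInner ha)⟩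
  obtain ⟨x'⟩ := (P.family ψ x).eff.1
  obtain ⟨y'⟩ := (P.family ψ y).eff.1
  exact congrArg Sigma.fst (h.1.elim ⟨x, x'⟩ ⟨y, y'⟩)

theorem IsCorolla.exists_flag_equiv {P : NGraph n Y} (hP : P.IsCorolla) (x : P.G.V) :
    ∃ t : n ≃ P.G.Flag x, ∀ k, (P.port k).1 = P.G.inv (P.G.s (t k).1) := by
  have := hP.1
  have inv_s_isPort (h : P.G.H) : P.G.IsPort (P.G.inv (P.G.s h)) := fun hh => hP.2 _ ⟨⟨h, rfl⟩, hh⟩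
  let opposite (h : P.G.Flag x) : {a : P.G.A // P.G.IsPort a} := ⟨_, inv_s_isPort h.1⟩
  have bijective_opposite : Function.Bijective opposite := by
    refine ⟨fun h k e => Subtype.ext (P.G.s_inj ?_), fun ⟨a, ha⟩ => ?_⟩
    · exact Function.Involutive.injective P.G.inv_inv (congrArg Subtype.val e)
    · obtain ⟨h, e⟩ := (P.eff.2 a).resolve_left ha
      exact ⟨⟨h, Subsingleton.elim _ _⟩, Subtype.ext (by simp only [opposite, e, P.G.inv_inv])⟩
  let t := Equiv.ofBijective opposite bijective_opposite
  exact ⟨P.port.trans t.symm, fun k => (congrArg Subtype.val (t.apply_symm_apply (P.port k))).symm⟩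

theorem IsCorolla.exists_rel {P : NGraph n Y} (hP : P.IsCorolla) :
    ∃ (y : Y.V) (j : n ≃ Y.Flag y), Rel P ((corolla (Etale.id Y) y).reindex j) := by
  obtain ⟨x⟩ := P.eff.1
  have := hP.1
  obtain ⟨t, port_eq⟩ := hP.exists_flag_equiv x
  have rel : Rel ((corolla P.map x).reindex t) P := by
    refine ⟨P.G.corollaMap x, isInvertible_of ((corolla P.map x).reindex t) P _ ⟨fun _ _ _ => rfl,
      fun y => ⟨PUnit.unit, Subsingleton.elim _ _⟩⟩ ?_, ?_, rfl⟩ <;>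
    exact fun k => (port_eq k).symm
  exact ⟨P.map.vert x, t.trans (P.map.flagEquiv x),
    rel.symm.trans (Rel.reindex t (corolla_rel P.map x))⟩

end NGraph

namespace NClass

variable {m n : Type u} {Y Z : JKGraph.{u}}

theorem reindex_symm_reindex (e : m ≃ n) (c : NClass m Y) :
    (c.reindex e.symm).reindex e = c := by
  induction c using Quotient.inductionOn with | h P => ?_
  have : (P.reindex e.symm).reindex e = P := by
    simp only [NGraph.reindex, ← Equiv.trans_assoc, Equiv.self_trans_symm, Equiv.refl_trans]
  exact congrArg (Quotient.mk _) this

theorem reindex_injective (e : m ≃ n) : Function.Injective (reindex (Y := Y) e) :=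
  Function.LeftInverse.injective (reindex_symm_reindex e.symm)

theorem mk_reindex_out (e : m ≃ n) (c : NClass n Y) :
    Quotient.mk _ (c.out.reindex e) = c.reindex e :=
  congrArg (reindex e) (Quotient.out_eq c)

theorem boundary_reindex (e : m ≃ n) (c : NClass n Y) (k : m) :
    (c.reindex e).boundary k = c.boundary (e k) := by
  induction c using Quotient.inductionOn
  rfl

theorem exists_reindex_flagEquiv {G G' : JKGraph.{u}} (f : Etale G G')
    (hf : Function.Bijective f.vert) (c : ∀ x, NClass (G.Flag x) Z) :
    ∃ c' : ∀ y, NClass (G'.Flag y) Z, ∀ x, (c' (f.vert x)).reindex (f.flagEquiv x) = c x := by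
  have exists_class (y : G'.V) : ∃ c' : NClass (G'.Flag y) Z,
      ∀ x (hx : f.vert x = y), c'.reindex (hx ▸ f.flagEquiv x) = c x := by
    obtain ⟨x, rfl⟩ := hf.2 y
    refine ⟨(c x).reindex (f.flagEquiv x).symm, fun x' hx => ?_⟩
    obtain rfl := hf.1 hx
    exact reindex_symm_reindex _ _
  choose c' hc' using exists_class
  exact ⟨c', fun x => hc' _ x rfl⟩

end NClass

namespace KHom

variable {R R' S Y Z : JKGraph.{u}}

theorem free_comp_sub (f : Etale R Y) (φ : KHom Y Z) (x : R.V) :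
    ((free f).comp φ).sub x = (φ.sub (f.vert x)).reindex (f.flagEquiv x) :=
  (Quotient.sound (NGraph.bind_corolla f φ x)).trans (NClass.mk_reindex_out _ _)

theorem free_sub (f : Etale R Y) (x : R.V) :
    (free f).sub x = ((KHom.id Y).sub (f.vert x)).reindex (f.flagEquiv x) :=
  Quotient.sound (NGraph.corolla_rel f x)

theorem free_comp_free (f : Etale R Y) (g : Etale Y Z) :
    (free f).comp (free g) = free (f.comp g) := by
  ext x
  · rfl
  · rw [free_comp_sub, free_sub, free_sub, Etale.flagEquiv_comp]
    rfl

theorem free_injective : Function.Injective (free (G := R) (G' := Y)) := by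
  intro f g e
  have arc_eq : f.arc = g.arc := congrArg KHom.arc e
  ext t
  · exact congrFun arc_eq t
  · apply Y.s_inj
    rw [← f.arc_s, ← g.arc_s, arc_eq]
  · have sub_eq : (free f).sub t = (free g).sub t := by rw [e]
    obtain ⟨i, -, -, hi⟩ := Quotient.exact sub_eq
    exact congrArg (fun k => k.vert PUnit.unit) hi.symm

theorem free_comp_cancel (f : Etale R Y) (ha : Function.Surjective f.arc)
    (hv : Function.Surjective f.vert) {φ ψ : KHom Y Z} (e : (free f).comp φ = (free f).comp ψ) :
    φ = ψ := by
  ext y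
  · obtain ⟨x, rfl⟩ := ha y
    exact congrFun (congrArg KHom.arc e) x
  · obtain ⟨x, rfl⟩ := hv y
    refine NClass.reindex_injective (f.flagEquiv x) ?_
    rw [← free_comp_sub, ← free_comp_sub, e]

theorem exists_eq_free_of_isCorolla (φ : KHom R Y) (hφ : ∀ x, (φ.sub x).out.IsCorolla) :
    ∃ f : Etale R Y, φ = free f := by
  choose y j rel using fun x => (hφ x).exists_rel
  have sub_eq (x : R.V) : φ.sub x = ((KHom.id Y).sub (y x)).reindex (j x) :=
    (Quotient.out_eq (φ.sub x)).symm.trans (Quotient.sound (rel x))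
  have arc_s (x : R.V) (h : R.Flag x) : φ.arc (R.s h.1) = Y.s (j x h).1 := by
    have compat : Y.inv (Y.s (j x h).1) = φ.arc (R.inv (R.s h.1)) := by
      rw [← φ.compat, sub_eq]
      rfl
    rw [← Y.inv_inv (φ.arc _), ← φ.arc_inv, ← compat, Y.inv_inv]
  refine ⟨Etale.ofFlagEquiv φ.arc φ.arc_inv y j arc_s, KHom.ext rfl ?_⟩
  funext x
  rw [free_sub, Etale.flagEquiv_ofFlagEquiv]
  exact sub_eq x

theorem exists_eq_free_of_comp_eq_free {φ : KHom R Y} {ψ : KHom Y Z} {f : Etale R Z}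
    (e : φ.comp ψ = free f) : ∃ g : Etale R Y, φ = free g := by
  refine exists_eq_free_of_isCorolla φ fun x => ?_
  have bind_eq : (φ.sub x).bind ψ = Quotient.mk _ (NGraph.corolla f x) :=
    congrFun (congrArg KHom.sub e) x
  rw [← Quotient.out_eq (φ.sub x)] at bind_eq
  exact NGraph.IsCorolla.of_bind ((NGraph.isCorolla_corolla f x).of_rel (Quotient.exact bind_eq))

theorem bijective_colimitMap_vert_iff (φ : KHom R Y) (K : ∀ x, NGraph (R.Flag x) Y)
    (hK : ∀ x, φ.sub x = Quotient.mk _ (K x)) :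
    Function.Bijective φ.colimitMap.vert ↔
      Function.Bijective fun z : Σ x, (K x).G.V => (K z.1).map.vert z.2 := by
  have rel (x : R.V) : NGraph.Rel (φ.sub x).out (K x) := hK x ▸ NGraph.out_rel (K x)
  choose e he _ hmap using rel
  let t : (Σ x, (φ.sub x).out.G.V) ≃ Σ x, (K x).G.V :=
    Equiv.sigmaCongrRight fun x => Equiv.ofBijective (e x).vert (he x).2.2
  rw [← Function.Bijective.of_comp_iff _ t.bijective]
  refine iff_of_eq (congrArg Function.Bijective (funext fun z => ?_))
  exact (congrArg (fun k => k.vert z.2) (hmap z.1)).symm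

theorem bijective_colimitMap_free_vert_iff (f : Etale R Y) :
    Function.Bijective (free f).colimitMap.vert ↔ Function.Bijective f.vert := by
  rw [bijective_colimitMap_vert_iff (free f) (NGraph.corolla f) fun _ => rfl]
  exact Function.Bijective.of_comp_iff f.vert (Equiv.sigmaPUnit R.V).bijective

theorem bijective_colimitMap_comp_vert_iff {φ : KHom R Y} {ψ : KHom Y Z}
    (hφ : Function.Bijective φ.colimitMap.vert) :
    Function.Bijective (φ.comp ψ).colimitMap.vert ↔ Function.Bijective ψ.colimitMap.vert := by
  have sub_eq (x : R.V) : (φ.comp ψ).sub x = Quotient.mk _ ((φ.sub x).out.bind ψ) :=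
    congrArg (fun c => NClass.bind c ψ) (Quotient.out_eq (φ.sub x)).symm
  let t : (Σ x : R.V, Σ v : (φ.sub x).out.G.V, (ψ.sub ((φ.sub x).out.map.vert v)).out.G.V) ≃
      Σ y : Y.V, (ψ.sub y).out.G.V :=
    (Equiv.sigmaAssoc fun x (v : (φ.sub x).out.G.V) =>
      (ψ.sub ((φ.sub x).out.map.vert v)).out.G.V).symm.trans
      (Equiv.sigmaCongrLeft (β := fun y => (ψ.sub y).out.G.V) (Equiv.ofBijective _ hφ))
  rw [bijective_colimitMap_vert_iff _ _ sub_eq]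
  exact Function.Bijective.of_comp_iff ψ.colimitMap.vert t.bijective

theorem isGeneric_iff (φ : KHom R Y) (hR : R.NoIsolatedEdges) (hY : Y.NoIsolatedEdges) :
    φ.IsGeneric ↔
      Function.Bijective φ.colimitMap.vert ∧ ∀ a, R.IsPort a → Y.IsPort (φ.arc a) := by
  refine ⟨fun hφ => ⟨hφ.2.2, fun a ha => hφ.isPort_arc ((JKGraph.glue_inl_isPort a).2 ha)⟩,
    fun ⟨hv, hp⟩ => ?_⟩
  refine Etale.isInvertible_of_isPort_arc _ (JKGraph.glue_noIsolatedEdges hR) hY hv ?_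
  rintro (a | a) ha
  · exact hp a ((JKGraph.glue_inl_isPort a).1 ha)
  · exact absurd (JKGraph.glue_inr_mem a) ha

theorem isGeneric_free_iff (f : Etale R Y) (hR : R.NoIsolatedEdges) (hY : Y.NoIsolatedEdges) :
    (free f).IsGeneric ↔ f.IsInvertible := by
  rw [isGeneric_iff _ hR hY, bijective_colimitMap_free_vert_iff]
  exact ⟨fun h => f.isInvertible_of_isPort_arc hR hY h.1 h.2,
    fun h => ⟨h.2.2, fun _ => h.isPort_arc⟩⟩

theorem IsGeneric.comp {φ : KHom R Y} {ψ : KHom Y Z} (hR : R.NoIsolatedEdges)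
    (hY : Y.NoIsolatedEdges) (hZ : Z.NoIsolatedEdges) (hφ : φ.IsGeneric) (hψ : ψ.IsGeneric) :
    (φ.comp ψ).IsGeneric := by
  rw [isGeneric_iff _ hR hY] at hφ
  rw [isGeneric_iff _ hY hZ] at hψ
  rw [isGeneric_iff _ hR hZ, bijective_colimitMap_comp_vert_iff hφ.1]
  exact ⟨hψ.1, fun a ha => hψ.2 _ (hφ.2 a ha)⟩

theorem exists_free_comp_eq (f : Etale S Y) (hv : Function.Bijective f.vert)
    (ha : Function.Surjective f.arc) (ψ : KHom S Z) (h : ψ.arc.FactorsThrough f.arc) :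
    ∃ θ : KHom Y Z, (free f).comp θ = ψ := by
  let arc : Y.A → Z.A := ψ.arc ∘ Function.surjInv ha
  have arc_f (a : S.A) : arc (f.arc a) = ψ.arc a := h (Function.surjInv_eq ha _)
  obtain ⟨sub, hsub⟩ := NClass.exists_reindex_flagEquiv f hv ψ.sub
  refine ⟨⟨arc, fun a => ?_, sub, fun y k => ?_⟩, ?_⟩
  · obtain ⟨a, rfl⟩ := ha a
    rw [← f.arc_inv, arc_f, arc_f, ψ.arc_inv]
  · obtain ⟨x, rfl⟩ := hv.2 y
    obtain ⟨k, rfl⟩ := (f.flagEquiv x).surjective k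
    rw [← NClass.boundary_reindex, hsub, ψ.compat, Etale.flagEquiv_val, ← f.arc_s, ← f.arc_inv,
      arc_f]
  · ext x
    · exact arc_f x
    · exact (free_comp_sub f _ x).trans (hsub x)

theorem IsGeneric.exists_etale_glue {g : KHom R S} (hg : g.IsGeneric) (f : Etale R R')
    (hf : Function.Bijective f.vert) (hR : R.NoIsolatedEdges) :
    ∃ (K' : ∀ y, NGraph (R'.Flag y) S) (q : Etale S (R'.glue K')), Function.Bijective q.vert ∧
      (∀ a, q.arc (g.arc a) = Sum.inl (f.arc a)) ∧
      ∀ a b, q.arc a = q.arc b →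
        a = b ∨ ∃ a' b', a = g.arc a' ∧ b = g.arc b' ∧ f.arc a' = f.arc b' := by
  obtain ⟨c, hc⟩ := NClass.exists_reindex_flagEquiv f hf g.sub
  have rel (x : R.V) : NGraph.Rel (g.sub x).out ((c (f.vert x)).out.reindex (f.flagEquiv x)) :=
    Quotient.exact ((Quotient.out_eq _).trans ((hc x).symm.trans (NClass.mk_reindex_out _ _).symm))
  obtain ⟨F, F_inl, F_vert, -⟩ :=
    JKGraph.exists_glueHom (K := fun x => (g.sub x).out) (K' := fun y => (c y).out) f rel
  have hF : Function.Bijective F.vert := F_vert hf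
  obtain ⟨i, colimitMap_comp, comp_colimitMap⟩ := Etale.IsInvertible.exists_inverse hg
  have hi : Function.Bijective i.vert :=
    (Etale.isInvertible_of_inverse comp_colimitMap colimitMap_comp).2.2
  have q_arc (b : g.colimitGraph.A) : (i.comp F).arc (g.colimitMap.arc b) = F.arc b :=
    congrArg (fun e : Etale g.colimitGraph g.colimitGraph => F.arc (e.arc b)) colimitMap_comp
  have q_inl (a : R.A) : (i.comp F).arc (g.arc a) = Sum.inl (f.arc a) :=
    (q_arc (Sum.inl a)).trans (F_inl a)
  refine ⟨fun y => (c y).out, i.comp F, hF.comp hi, q_inl, fun a b e => ?_⟩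
  obtain ⟨a, rfl⟩ := hg.1.2 a
  obtain ⟨b, rfl⟩ := hg.1.2 b
  rw [q_arc, q_arc] at e
  rcases JKGraph.eq_or_inl_of_glue_arc_eq F hF.1 hR e with rfl | ⟨a, b, rfl, rfl⟩
  · exact Or.inl rfl
  · rw [F_inl, F_inl] at e
    exact Or.inr ⟨a, b, rfl, rfl, Sum.inl.inj e⟩

theorem IsGeneric.exists_square {g : KHom R S} (hg : g.IsGeneric) (f : Etale R R')
    (hf : Function.Bijective f.vert) (hR : R.NoIsolatedEdges) (hR' : R'.NoIsolatedEdges)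
    (hS : S.NoIsolatedEdges) :
    ∃ (S' : JKGraph.{u}) (q : Etale S S') (g' : KHom R' S'), S'.NoIsolatedEdges ∧
      Function.Bijective q.vert ∧ g'.IsGeneric ∧ g.comp (free q) = (free f).comp g' ∧
      ∀ a b, q.arc a = q.arc b →
        a = b ∨ ∃ a' b', a = g.arc a' ∧ b = g.arc b' ∧ f.arc a' = f.arc b' := by
  obtain ⟨K', q, hq, q_inl, q_arc_eq⟩ := hg.exists_etale_glue f hf hR
  have hS' : (R'.glue K').NoIsolatedEdges := JKGraph.glue_noIsolatedEdges hR'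
  have f_surj : Function.Surjective f.arc := f.arc_surjective hf.2 hR'
  obtain ⟨g', hg'⟩ := exists_free_comp_eq f hf f_surj (g.comp (free q)) fun a b e =>
    (q_inl a).trans ((congrArg Sum.inl e).trans (q_inl b).symm)
  refine ⟨R'.glue K', q, g', hS', hq, (isGeneric_iff g' hR' hS').2 ⟨?_, fun b hb => ?_⟩, hg'.symm,
    q_arc_eq⟩
  · have hf' := (bijective_colimitMap_free_vert_iff f).2 hf
    have hgv := ((isGeneric_iff g hR hS).1 hg).1
    rw [← bijective_colimitMap_comp_vert_iff hf', hg', bijective_colimitMap_comp_vert_iff hgv]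
    exact (bijective_colimitMap_free_vert_iff q).2 hq
  · obtain ⟨a, rfl⟩ := f_surj b
    have g'_arc : g'.arc (f.arc a) = Sum.inl (f.arc a) :=
      (congrArg (fun φ => φ.arc a) hg').trans (q_inl a)
    rw [g'_arc]
    exact (JKGraph.glue_inl_isPort _).2 hb

end KHom

namespace KleisliGraph

variable {R R' S X Y Z : KleisliGraph.{u}}

/-- The free morphism of an etale morphism, as an arrow of the restricted Kleisli category. -/
def freeHom (f : Etale R.graph Y.graph) : R ⟶ Y := KHom.free f

theorem freeHom_comp (f : Etale X.graph Y.graph) (g : Etale Y.graph Z.graph) :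
    freeHom f ≫ freeHom g = freeHom (f.comp g) :=
  KHom.free_comp_free f g

theorem reducedCovers_iff (r : R ⟶ R') :
    reducedCovers r ↔
      ∃ f : Etale R.graph R'.graph, Function.Bijective f.vert ∧ r = freeHom f := by
  refine exists_congr fun f => and_congr_left fun _ => ?_
  exact f.isReducedCover_iff R.noIsolatedEdges R'.noIsolatedEdges

theorem epi_freeHom (f : Etale R.graph R'.graph) (hf : Function.Bijective f.vert) :
    Epi (freeHom f) :=
  ⟨fun _ _ e => KHom.free_comp_cancel f (f.arc_surjective hf.2 R'.noIsolatedEdges) hf.2 e⟩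

theorem epi_of_reducedCovers (r : R ⟶ R') (hr : reducedCovers r) : Epi r := by
  obtain ⟨f, hf, rfl⟩ := (reducedCovers_iff r).1 hr
  exact epi_freeHom f hf

theorem isIso_freeHom (f : Etale R.graph Y.graph) (hf : f.IsInvertible) : IsIso (freeHom f) := by
  obtain ⟨g, comp_g, g_comp⟩ := hf.exists_inverse
  exact ⟨freeHom g, (freeHom_comp f g).trans (congrArg KHom.free comp_g),
    (freeHom_comp g f).trans (congrArg KHom.free g_comp)⟩

theorem exists_eq_freeHom_of_isIso_comp (φ : X ⟶ Y) (ψ : Y ⟶ Z) [IsIso (φ ≫ ψ)] :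
    ∃ f : Etale X.graph Y.graph, φ = freeHom f :=
  KHom.exists_eq_free_of_comp_eq_free (f := Etale.id X.graph)
    ((Category.assoc φ ψ (inv (φ ≫ ψ))).symm.trans (IsIso.hom_inv_id (φ ≫ ψ)))

theorem exists_isInvertible_of_isIso (φ : X ⟶ Y) [IsIso φ] :
    ∃ f : Etale X.graph Y.graph, f.IsInvertible ∧ φ = freeHom f := by
  obtain ⟨f, hf⟩ := exists_eq_freeHom_of_isIso_comp φ (𝟙 Y)
  obtain ⟨g, hg⟩ := exists_eq_freeHom_of_isIso_comp (inv φ) (𝟙 X)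
  have comp_g : freeHom (f.comp g) = 𝟙 X := by
    rw [← freeHom_comp, ← hf, ← hg, IsIso.hom_inv_id]
  have g_comp : freeHom (g.comp f) = 𝟙 Y := by
    rw [← freeHom_comp, ← hf, ← hg, IsIso.inv_hom_id]
  exact ⟨f, Etale.isInvertible_of_inverse (KHom.free_injective comp_g)
    (KHom.free_injective g_comp), hf⟩

theorem isIso_of_genericMorphisms (φ : X ⟶ Y) (ψ : Y ⟶ Z) (hφ : genericMorphisms φ)
    [IsIso (φ ≫ ψ)] : IsIso φ := by
  obtain ⟨f, rfl⟩ := exists_eq_freeHom_of_isIso_comp φ ψ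
  exact isIso_freeHom f ((KHom.isGeneric_free_iff f X.noIsolatedEdges Y.noIsolatedEdges).1 hφ)

theorem isPushout_of_arc_eq {S' : KleisliGraph.{u}} {g : R ⟶ S} {f : Etale R.graph R'.graph}
    {q : Etale S.graph S'.graph} {g' : R' ⟶ S'} (hf : Function.Bijective f.vert)
    (hq : Function.Bijective q.vert) (w : g ≫ freeHom q = freeHom f ≫ g')
    (q_arc_eq : ∀ a b, q.arc a = q.arc b →
      a = b ∨ ∃ a' b', a = KHom.arc g a' ∧ b = KHom.arc g b' ∧ f.arc a' = f.arc b') :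
    IsPushout g (freeHom f) (freeHom q) g' := by
  have := epi_freeHom f hf
  have := epi_freeHom q hq
  have desc (s : Limits.PushoutCocone g (freeHom f)) : ∃ θ : S' ⟶ s.pt, freeHom q ≫ θ = s.inl := by
    refine KHom.exists_free_comp_eq q hq (q.arc_surjective hq.2 S'.noIsolatedEdges) s.inl ?_
    intro a b e
    have condition (c : R.graph.A) :
        KHom.arc s.inl (KHom.arc g c) = KHom.arc s.inr (f.arc c) :=
      congrFun (congrArg KHom.arc s.condition) c
    rcases q_arc_eq a b e with rfl | ⟨a, b, rfl, rfl, hab⟩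
    · rfl
    · rw [condition, condition, hab]
  choose θ inl_θ using desc
  refine ⟨⟨w⟩, ⟨Limits.PushoutCocone.IsColimit.mk w θ inl_θ (fun s => ?_) fun s m hm _ => ?_⟩⟩
  · rw [← cancel_epi (freeHom f), ← reassoc_of% w, inl_θ, s.condition]
  · rw [← cancel_epi (freeHom q), inl_θ, hm]

theorem exists_isPushout (g : R ⟶ S) (r : R ⟶ R') (hg : genericMorphisms g)
    (hr : reducedCovers r) :
    ∃ (S' : KleisliGraph.{u}) (r' : S ⟶ S') (g' : R' ⟶ S'),
      IsPushout g r r' g' ∧ reducedCovers r' ∧ genericMorphisms g' := by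
  obtain ⟨f, hf, rfl⟩ := (reducedCovers_iff r).1 hr
  obtain ⟨S', q, g', hS', hq, hg', w, q_arc_eq⟩ := KHom.IsGeneric.exists_square hg f hf
    R.noIsolatedEdges R'.noIsolatedEdges S.noIsolatedEdges
  exact ⟨⟨S', hS'⟩, freeHom q, g', isPushout_of_arc_eq hf hq w q_arc_eq,
    (reducedCovers_iff _).2 ⟨q, hq, rfl⟩, hg'⟩

theorem reducedCovers_comp (φ : X ⟶ Y) (ψ : Y ⟶ Z) (hφ : reducedCovers φ)
    (hψ : reducedCovers ψ) : reducedCovers (φ ≫ ψ) := by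
  obtain ⟨f, hf, rfl⟩ := (reducedCovers_iff φ).1 hφ
  obtain ⟨g, hg, rfl⟩ := (reducedCovers_iff ψ).1 hψ
  exact (reducedCovers_iff _).2 ⟨f.comp g, hg.comp hf, freeHom_comp f g⟩

theorem cospanClasses : CospanClasses reducedCovers.{u} genericMorphisms.{u} where
  iso_left φ _ := by
    obtain ⟨f, hf, rfl⟩ := exists_isInvertible_of_isIso φ
    exact (reducedCovers_iff _).2 ⟨f, hf.2.2, rfl⟩
  iso_right {X Y} φ _ := by
    obtain ⟨f, hf, rfl⟩ := exists_isInvertible_of_isIso φ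
    exact (KHom.isGeneric_free_iff f X.noIsolatedEdges Y.noIsolatedEdges).2 hf
  comp_left := reducedCovers_comp
  comp_right {X Y Z} _ _ :=
    KHom.IsGeneric.comp X.noIsolatedEdges Y.noIsolatedEdges Z.noIsolatedEdges
  pushout := exists_isPushout

end KleisliGraph

namespace CospanCategory

variable {C : Type u} [Category.{v} C] {E M : MorphismProperty C} {h : CospanClasses E M}

section Legs

variable {X Y Z Z' : CospanCategory h}

/-- The cospan `T → R = R`, as an arrow of the category of cospans. -/
def leftHom (r : X.obj ⟶ Y.obj) (hr : E r) : X ⟶ Y :=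
  CospanClass.mk r (𝟙 Y.obj) hr (h.iso_right _ inferInstance)

/-- The cospan `T = T ← R`, as an arrow of the category of cospans. -/
def rightHom (g : Y.obj ⟶ X.obj) (hg : M g) : X ⟶ Y :=
  CospanClass.mk (𝟙 X.obj) g (h.iso_left _ inferInstance) hg

theorem leftHom_inj {r r' : X.obj ⟶ Y.obj} {hr : E r} {hr' : E r'} :
    leftHom r hr = leftHom r' hr' ↔ r = r' := by
  refine ⟨fun eq => ?_, fun eq => by subst eq; rfl⟩
  obtain ⟨e, r_e, id_e⟩ := Quotient.exact eq
  have e_hom : e.hom = 𝟙 Y.obj := (Category.id_comp e.hom).symm.trans id_e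
  rwa [e_hom, Category.comp_id] at r_e

theorem leftHom_hom_eq_rightHom_inv (e : X.obj ≅ Y.obj) (he : E e.hom) (he' : M e.inv) :
    leftHom e.hom he = rightHom e.inv he' :=
  CospanClass.mk_eq e.symm e.hom_inv_id (Category.id_comp _)

theorem leftHom_comp_leftHom (f : X.obj ⟶ Y.obj) (hf : E f) (g : Y.obj ⟶ Z.obj) (hg : E g) :
    leftHom f hf ≫ leftHom g hg = leftHom (f ≫ g) (h.comp_left _ _ hf hg) := by
  refine (h.comp_mk (IsPushout.of_id_fst (f := g)) hg (h.iso_right _ inferInstance)).trans ?_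
  exact CospanClass.mk_eq (Iso.refl _) (Category.comp_id _) (by simp)

theorem rightHom_comp_rightHom (f : Y.obj ⟶ X.obj) (hf : M f) (g : Z.obj ⟶ Y.obj) (hg : M g) :
    rightHom f hf ≫ rightHom g hg = rightHom (g ≫ f) (h.comp_right _ _ hg hf) := by
  refine (h.comp_mk (IsPushout.of_id_snd (f := f)) (h.iso_left _ inferInstance) hf).trans ?_
  exact CospanClass.mk_eq (Iso.refl _) (by simp) (Category.comp_id _)

theorem leftHom_comp_rightHom (f : X.obj ⟶ Y.obj) (hf : E f) (g : Z.obj ⟶ Y.obj) (hg : M g) :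
    leftHom f hf ≫ rightHom g hg = CospanClass.mk f g hf hg := by
  refine (h.comp_mk (IsPushout.of_id_fst (f := 𝟙 Y.obj)) (h.iso_left _ inferInstance)
    (h.iso_right _ inferInstance)).trans ?_
  exact CospanClass.mk_eq (Iso.refl _) (by simp) (by simp)

theorem rightHom_comp_leftHom_of_isPushout {g : Y.obj ⟶ X.obj} {f : Y.obj ⟶ Z.obj}
    {i : X.obj ⟶ Z'.obj} {j : Z.obj ⟶ Z'.obj} (sq : IsPushout g f i j) (hg : M g) (hf : E f)
    (hi : E i) (hj : M j) :
    rightHom g hg ≫ leftHom f hf = leftHom i hi ≫ rightHom j hj := by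
  rw [leftHom_comp_rightHom]
  refine (h.comp_mk sq hi hj).trans ?_
  exact CospanClass.mk_eq (Iso.refl _) (by simp) (by simp)

theorem exists_eq_leftHom_comp_rightHom (c : X ⟶ Y) :
    ∃ (S : CospanCategory h) (f : X.obj ⟶ S.obj) (g : Y.obj ⟶ S.obj) (hf : E f) (hg : M g),
      c = leftHom f hf ≫ rightHom g hg := by
  obtain ⟨⟨S, f, g, hf, hg⟩, rfl⟩ := Quotient.exists_rep c
  exact ⟨⟨S⟩, f, g, hf, hg, (leftHom_comp_rightHom f hf g hg).symm⟩

theorem exists_iso_of_leftHom_comp_rightHom_eq {f : X.obj ⟶ Z.obj} {g : Y.obj ⟶ Z.obj}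
    {f' : X.obj ⟶ Z'.obj} {g' : Y.obj ⟶ Z'.obj} {hf : E f} {hg : M g} {hf' : E f'} {hg' : M g'}
    (eq : leftHom f hf ≫ rightHom g hg = leftHom f' hf' ≫ rightHom g' hg') :
    ∃ e : Z.obj ≅ Z'.obj, f ≫ e.hom = f' ∧ g ≫ e.hom = g' := by
  rw [leftHom_comp_rightHom, leftHom_comp_rightHom] at eq
  exact Quotient.exact eq

/-- An isomorphism of `C`, as an isomorphism in the category of cospans. -/
@[simps]
def leftIso (e : X.obj ≅ Y.obj) : X ≅ Y where
  hom := leftHom e.hom (h.iso_left _ inferInstance)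
  inv := leftHom e.inv (h.iso_left _ inferInstance)
  hom_inv_id := (leftHom_comp_leftHom _ _ _ _).trans (leftHom_inj.2 e.hom_inv_id)
  inv_hom_id := (leftHom_comp_leftHom _ _ _ _).trans (leftHom_inj.2 e.inv_hom_id)

end Legs

section Isomorphisms

variable {X Y Z Z' : CospanCategory h} (hE : E ≤ MorphismProperty.epimorphisms C)
  (hM : ∀ {X Y Z : C} (f : X ⟶ Y) (g : Y ⟶ Z), M f → M g → IsIso (f ≫ g) → IsIso f)

include hE hM

theorem isIso_legs_of_comp_eq_id {S S' : CospanCategory h} {f : X.obj ⟶ S.obj}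
    {g : Y.obj ⟶ S.obj} {f' : Y.obj ⟶ S'.obj} {g' : X.obj ⟶ S'.obj} {hf : E f} {hg : M g}
    {hf' : E f'} {hg' : M g'}
    (eq : (leftHom f hf ≫ rightHom g hg) ≫ leftHom f' hf' ≫ rightHom g' hg' = 𝟙 X) :
    IsIso f ∧ IsIso g' := by
  obtain ⟨P, i, j, sq, hi, hj⟩ := h.pushout g f' hg hf'
  have comp_eq : leftHom (Y := ⟨P⟩) (f ≫ i) (h.comp_left _ _ hf hi) ≫
      rightHom (g' ≫ j) (h.comp_right _ _ hg' hj) = 𝟙 X := by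
    rw [← leftHom_comp_leftHom (Y := S) f hf i hi, ← rightHom_comp_rightHom (Y := S') j hj g' hg',
      ← eq]
    simp only [Category.assoc]
    rw [reassoc_of% rightHom_comp_leftHom_of_isPushout (Z' := ⟨P⟩) sq hg hf' hi hj]
  rw [leftHom_comp_rightHom] at comp_eq
  obtain ⟨e, f_i_e, g_j_e⟩ := Quotient.exact comp_eq
  have f_split : f ≫ i ≫ e.hom = 𝟙 X.obj := (Category.assoc _ _ _).symm.trans f_i_e
  have : Epi f := hE f hf
  have : IsSplitMono f := ⟨⟨⟨i ≫ e.hom, f_split⟩⟩⟩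
  have g_j_eq : g' ≫ j = e.inv := (Iso.comp_hom_eq_id e).1 g_j_e
  exact ⟨isIso_of_epi_of_isSplitMono f, hM g' j hg' hj (g_j_eq ▸ inferInstance)⟩

theorem exists_isIso_legs (c : X ⟶ Y) [IsIso c] :
    ∃ (S : CospanCategory h) (f : X.obj ≅ S.obj) (g : Y.obj ≅ S.obj) (hf : E f.hom)
      (hg : M g.hom), c = leftHom f.hom hf ≫ rightHom g.hom hg := by
  obtain ⟨S, f, g, hf, hg, hc⟩ := exists_eq_leftHom_comp_rightHom c
  obtain ⟨S', f', g', hf', hg', hd⟩ := exists_eq_leftHom_comp_rightHom (inv c)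
  have := (isIso_legs_of_comp_eq_id hE hM (by rw [← hc, ← hd, IsIso.hom_inv_id])).1
  have := (isIso_legs_of_comp_eq_id hE hM (by rw [← hd, ← hc, IsIso.inv_hom_id])).2
  exact ⟨S, asIso f, asIso g, hf, hg, hc⟩

theorem exists_eq_leftHom_of_isIso (c : X ⟶ Y) [IsIso c] :
    ∃ e : X.obj ≅ Y.obj, c = (leftIso e).hom := by
  obtain ⟨S, f, g, hf, hg, rfl⟩ := exists_isIso_legs hE hM c
  have rightHom_eq : rightHom g.hom hg = leftHom g.inv (h.iso_left _ inferInstance) :=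
    (leftHom_hom_eq_rightHom_inv g.symm _ hg).symm
  exact ⟨f ≪≫ g.symm, by rw [rightHom_eq, leftHom_comp_leftHom]; rfl⟩

theorem leftCospans_of_isIso (c : X ⟶ Y) [IsIso c] : leftCospans h c := by
  obtain ⟨e, rfl⟩ := exists_eq_leftHom_of_isIso hE hM c
  exact ⟨e.hom, _, rfl⟩

theorem rightCospans_of_isIso (c : X ⟶ Y) [IsIso c] : rightCospans h c := by
  obtain ⟨e, rfl⟩ := exists_eq_leftHom_of_isIso hE hM c
  exact ⟨e.inv, _, leftHom_hom_eq_rightHom_inv e _ (h.iso_right _ inferInstance)⟩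

theorem existsUnique_comparison {l : X ⟶ Z} {r : Z ⟶ Y} {l' : X ⟶ Z'} {r' : Z' ⟶ Y}
    (hl : leftCospans h l) (hr : rightCospans h r) (hl' : leftCospans h l')
    (hr' : rightCospans h r') (eq : l ≫ r = l' ≫ r') :
    ∃! e : Z ≅ Z', l ≫ e.hom = l' ∧ e.hom ≫ r' = r := by
  obtain ⟨f, hf, rfl⟩ := hl
  obtain ⟨g, hg, rfl⟩ := hr
  obtain ⟨f', hf', rfl⟩ := hl'
  obtain ⟨g', hg', rfl⟩ := hr'
  obtain ⟨e, rfl, rfl⟩ := exists_iso_of_leftHom_comp_rightHom_eq eq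
  refine ⟨leftIso e, ⟨leftHom_comp_leftHom f hf e.hom _, ?_⟩, ?_⟩
  · rw [leftIso_hom, leftHom_hom_eq_rightHom_inv e _ (h.iso_right _ inferInstance)]
    refine (rightHom_comp_rightHom _ _ _ hg').trans ?_
    simp only [Category.assoc, Iso.hom_inv_id, Category.comp_id]
    rfl
  · rintro t ⟨f_t, -⟩
    obtain ⟨k, ht⟩ := exists_eq_leftHom_of_isIso hE hM t.hom
    have : Epi f := hE f hf
    have k_eq : k = e := by
      rw [ht] at f_t
      have := leftHom_inj.1 ((leftHom_comp_leftHom f hf k.hom _).symm.trans f_t)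
      exact Iso.ext ((cancel_epi f).1 this)
    exact Iso.ext (k_eq ▸ ht)

theorem isFactorisationSystem : IsFactorisationSystem (leftCospans h) (rightCospans h) where
  iso_left c _ := leftCospans_of_isIso hE hM c
  iso_right c _ := rightCospans_of_isIso hE hM c
  comp_left := by
    rintro X Y Z _ _ ⟨f, hf, rfl⟩ ⟨g, hg, rfl⟩
    exact ⟨f ≫ g, _, leftHom_comp_leftHom f hf g hg⟩
  comp_right := by
    rintro X Y Z _ _ ⟨f, hf, rfl⟩ ⟨g, hg, rfl⟩
    exact ⟨g ≫ f, _, rightHom_comp_rightHom f hf g hg⟩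
  exists_factorisation c := by
    obtain ⟨S, f, g, hf, hg, rfl⟩ := exists_eq_leftHom_comp_rightHom c
    exact ⟨S, leftHom f hf, rightHom g hg, ⟨f, hf, rfl⟩, ⟨g, hg, rfl⟩, rfl⟩
  unique_comparison _ _ _ _ := existsUnique_comparison hE hM

end Isomorphisms

end CospanCategory

theorem mainTheorem6 :
    (∀ (R R' : KleisliGraph.{u}) (r : R ⟶ R'), reducedCovers r → Epi r) ∧
      ∃ h : CospanClasses reducedCovers.{u} genericMorphisms.{u},
        IsFactorisationSystem (leftCospans h) (rightCospans h) :=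
  ⟨fun _ _ => KleisliGraph.epi_of_reducedCovers, KleisliGraph.cospanClasses,
    CospanCategory.isFactorisationSystem (fun _ _ => KleisliGraph.epi_of_reducedCovers)
      fun φ ψ hφ _ _ => KleisliGraph.isIso_of_genericMorphisms φ ψ hφ⟩
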